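/- Let $N\ge 1$ and $m\ge 1$ be integers, let $\rho_2,\dots,\rho_N\in(-1,1)$ and $\mu_1,\dots,\mu_N\in(-1,1)$, and let $\hat x_{n,k},\hat y_{n,k},x_{n,k},y_{n,k}$ ($1\le n\le N$, $1\le k\le m$) be independent real Gaussian random variables with mean $0$ and variance $1/2$. Define the estimated channels $$\hat g_{1,k}=\hat x_{1,k}+\jmath\hat y_{1,k},\qquad \hat g_{n,k}=\sqrt{1-\rho_n^2}\,\hat x_{n,k}+\rho_n\hat x_{1,k}+\jmath\big(\sqrt{1-\rho_n^2}\,\hat y_{n,k}+\rho_n\hat y_{1,k}\big)\quad(2\le n\le N),$$ the actual (outdated) channels $g_{n,k}=\sqrt{1-\mu_n^2}\,(x_{n,k}+\jmath y_{n,k})+\mu_n\hat g_{n,k}$, and the gains $\hat h_n=\sum_{k=1}^m|\hat g_{n,k}|^2$ and $h_n=\sum_{k=1}^m|g_{n,k}|^2$. Let $s$ be a random index in $\{1,\dots,N\}$ with $\hat h_s=\max_n\hat h_n$ (the activated port; ties are broken arbitrarily), let $E_n=\{s=n\}$, and let $h=h_s$ be the gain of the activated port. Let $I_\nu$ be the modified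 Bessel function of the first kind and, for $a,b\ge 0$, let $$Q_m(a,b)=\int_b^\infty t\Big(\frac ta\Big)^{m-1}e^{-(t^2+a^2)/2}I_{m-1}(at)\,dt,\qquad Q_m(0,b)=\frac{\Gamma(m,b^2/2)}{\Gamma(m)},$$ be the Marcum $Q$-function of order $m$. Put $\phi_n(z,x)=1-Q_m\Big(\sqrt{\tfrac{2z\rho_n^2}{1-\rho_n^2}},\sqrt{\tfrac{2x}{1-\rho_n^2}}\Big)$ and, for $x>0$, $$f_{\hat h_1|E_1}(x)=\frac{1}{\Gamma(m)}e^{-x}x^{m-1}\prod_{k=2}^N\phi_k(x,x),$$ $$f_{\hat h_n|E_n}(x)=\frac{1}{\Gamma(m)(1-\rho_n^2)}\int_0^x e^{-\frac{x+z}{1-\rho_n^2}}\Big(\frac{xz}{\rho_n^2}\Big)^{\frac{m-1}{2}}I_{m-1}\Big(\frac{2\sqrt{xz\rho_n^2}}{1-\rho_n^2}\Big)\prod_{\substack{k=2\\k\ne n}}^N\phi_k(z,x)\,dz\qquad(2\le n\le N),$$ where for $\rho_n=0$ the product of the power and the Bessel function is replaced by its limit $(xz)^{m-1}/\Gamma(m)$.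 Then $f_{\hat h_n|E_n}\ge 0$ is the density of $\hat h_n$ on the event $E_n$, that is, $\mathbb P(E_n\cap\{\hat h_n\in A\})=\int_{A\cap(0,\infty)}f_{\hat h_n|E_n}(y)\,dy$ for every Borel set $A\subseteq\mathbb R$ and every $n$; and for every $x\ge 0$ the cumulative distribution function $F_h(x)=\mathbb P(h\le x)$ is $$F_h(x)=1-\sum_{n=1}^N\int_0^\infty Q_m\Big(\sqrt{\tfrac{2y\mu_n^2}{1-\mu_n^2}},\sqrt{\tfrac{2x}{1-\mu_n^2}}\Big)f_{\hat h_n|E_n}(y)\,dy,$$ where all the integrals converge. -/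

import Mathlib

open MeasureTheory ProbabilityTheory Set

noncomputable section

namespace FluidAntenna

/-- The modified Bessel function of the first kind `I_ν(x)` of natural order `ν`. -/
def besselI (ν : ℕ) (x : ℝ) : ℝ :=
  ∑' k : ℕ, (x / 2) ^ (2 * k + ν) / ((k.factorial : ℝ) * ((k + ν).factorial : ℝ))

/-- The generalized Marcum `Q`-function `Q_m(a, b)` for `m ≥ 1` and `a, b ≥ 0`; the value at
`a = 0` is the limit `Γ(m, b²/2) / Γ(m)`. -/
def marcumQ (m : ℕ) (a b : ℝ) : ℝ :=
  if a = 0 then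
    (∫ t in Ioi (b ^ 2 / 2), t ^ (m - 1) * Real.exp (-t)) / Real.Gamma m
  else
    ∫ t in Ioi b, t * (t / a) ^ (m - 1) * Real.exp (-(t ^ 2 + a ^ 2) / 2) * besselI (m - 1) (a * t)

/-- The estimated channel `ĝ_{n,k}`; the first port has index `0`. -/
def estChannel {Ω : Type*} {N m : ℕ} [NeZero N] (ρ : Fin N → ℝ)
    (xh yh : Fin N → Fin m → Ω → ℝ) (n : Fin N) (k : Fin m) (ω : Ω) : ℂ :=
  if n = 0 then
    (xh 0 k ω : ℂ) + Complex.I * (yh 0 k ω : ℂ)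
  else
    ((√(1 - ρ n ^ 2) * xh n k ω + ρ n * xh 0 k ω : ℝ) : ℂ)
      + Complex.I * ((√(1 - ρ n ^ 2) * yh n k ω + ρ n * yh 0 k ω : ℝ) : ℂ)

/-- The actual channel `g_{n,k}`, a combination of the estimate and a fresh Gaussian term. -/
def outdatedChannel {Ω : Type*} {N m : ℕ} [NeZero N] (ρ μ : Fin N → ℝ)
    (xh yh x y : Fin N → Fin m → Ω → ℝ) (n : Fin N) (k : Fin m) (ω : Ω) : ℂ :=
  (√(1 - μ n ^ 2) : ℂ) * ((x n k ω : ℂ) + Complex.I * (y n k ω : ℂ))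
    + (μ n : ℂ) * estChannel ρ xh yh n k ω

/-- The estimated gain `ĥ_n = ∑_k |ĝ_{n,k}|²`. -/
def estGain {Ω : Type*} {N m : ℕ} [NeZero N] (ρ : Fin N → ℝ)
    (xh yh : Fin N → Fin m → Ω → ℝ) (n : Fin N) (ω : Ω) : ℝ :=
  ∑ k, ‖estChannel ρ xh yh n k ω‖ ^ 2

/-- The actual gain `h_n = ∑_k |g_{n,k}|²`. -/
def outdatedGain {Ω : Type*} {N m : ℕ} [NeZero N] (ρ μ : Fin N → ℝ)
    (xh yh x y : Fin N → Fin m → Ω → ℝ) (n : Fin N) (ω : Ω) : ℝ :=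
  ∑ k, ‖outdatedChannel ρ μ xh yh x y n k ω‖ ^ 2

/-- All the entries of the four arrays are independent `𝒩(0, 1/2)` variables. -/
structure IsGaussianModel {Ω : Type*} [MeasurableSpace Ω] (P : Measure Ω) {N m : ℕ}
    (xh yh x y : Fin N → Fin m → Ω → ℝ) : Prop where
  law_xh : ∀ n k, HasLaw (xh n k) (gaussianReal 0 (1 / 2)) P
  law_yh : ∀ n k, HasLaw (yh n k) (gaussianReal 0 (1 / 2)) P
  law_x : ∀ n k, HasLaw (x n k) (gaussianReal 0 (1 / 2)) P
  law_y : ∀ n k, HasLaw (y n k) (gaussianReal 0 (1 / 2)) P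
  indep : iIndepFun
    (fun i : Fin 4 × Fin N × Fin m => (![xh, yh, x, y] i.1) i.2.1 i.2.2) P

/-- `φ(z, x) = 1 - Q_m(√(2zρ²/(1-ρ²)), √(2x/(1-ρ²)))`. -/
def phi (m : ℕ) (ρ z x : ℝ) : ℝ :=
  1 - marcumQ m (√(2 * z * ρ ^ 2 / (1 - ρ ^ 2))) (√(2 * x / (1 - ρ ^ 2)))

/-- The factor `(xz/ρ²)^{(m-1)/2} I_{m-1}(2√(xzρ²)/(1-ρ²))`, with its limit
`(xz)^{m-1}/Γ(m)` as the value at `ρ = 0`. -/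
def besselFactor (m : ℕ) (ρ x z : ℝ) : ℝ :=
  if ρ = 0 then (x * z) ^ (m - 1) / Real.Gamma m
  else (x * z / ρ ^ 2) ^ (((m : ℝ) - 1) / 2)
    * besselI (m - 1) (2 * √(x * z * ρ ^ 2) / (1 - ρ ^ 2))

/-- The density `f_{ĥ_n | E_n}(x)` for `x > 0`; the first port has index `0`. -/
def selPdf (m : ℕ) {N : ℕ} [NeZero N] (ρ : Fin N → ℝ) (n : Fin N) (x : ℝ) : ℝ :=
  if n = 0 then
    1 / Real.Gamma m * Real.exp (-x) * x ^ (m - 1)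
      * ∏ k ∈ Finset.univ.erase (0 : Fin N), phi m (ρ k) x x
  else
    1 / (Real.Gamma m * (1 - ρ n ^ 2)) *
      ∫ z in (0 : ℝ)..x, Real.exp (-((x + z) / (1 - ρ n ^ 2))) * besselFactor m (ρ n) x z
        * ∏ k ∈ (Finset.univ.erase (0 : Fin N)).erase n, phi m (ρ k) z x

end FluidAntenna

end

noncomputable section

namespace FluidAntenna

/-- The entire function `∑ v ^ k / (k! (k + ν)!)`, the even part of the Bessel function `I_ν`. -/
def besselSeries (ν : ℕ) (v : ℝ) : ℝ :=
  ∑' k : ℕ, v ^ k / ((k.factorial : ℝ) * ((k + ν).factorial : ℝ))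

/-- The density in `u > 0` of the squared norm of a standard complex Gaussian vector in dimension
`ν + 1` shifted by a vector of squared norm `w`. -/
def ncPdf (ν : ℕ) (w u : ℝ) : ℝ :=
  Real.exp (-(u + w)) * u ^ ν * besselSeries ν (w * u)

lemma abs_besselSeries_term_le (ν k : ℕ) {v R : ℝ} (h : |v| ≤ R) :
    ‖v ^ k / ((k.factorial : ℝ) * ((k + ν).factorial : ℝ))‖ ≤ R ^ k / (k.factorial : ℝ) := by
  have h1 : (1 : ℝ) ≤ ((k + ν).factorial : ℝ) := by exact_mod_cast (Nat.factorial_pos _)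
  have h2 : (0 : ℝ) < (k.factorial : ℝ) := by exact_mod_cast (Nat.factorial_pos _)
  have hR : 0 ≤ R := (abs_nonneg _).trans h
  rw [Real.norm_eq_abs, abs_div, abs_pow, abs_of_nonneg (by positivity : (0 : ℝ) ≤
    (k.factorial : ℝ) * ((k + ν).factorial : ℝ))]
  gcongr
  nlinarith

lemma continuous_besselSeries (ν : ℕ) : Continuous (besselSeries ν) := by
  rw [continuous_iff_continuousAt]
  intro v
  have h : ContinuousOn (besselSeries ν) (Metric.ball 0 (|v| + 1)) := by
    refine continuousOn_tsum (fun k => by fun_prop)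
      (Real.summable_pow_div_factorial (|v| + 1)) fun k x hx => ?_
    refine abs_besselSeries_term_le ν k ?_
    simpa using (mem_ball_zero_iff.1 hx).le
  exact h.continuousAt (Metric.isOpen_ball.mem_nhds (by simp))

lemma besselSeries_nonneg (ν : ℕ) {v : ℝ} (hv : 0 ≤ v) : 0 ≤ besselSeries ν v :=
  tsum_nonneg fun k => by positivity

lemma besselSeries_zero (ν : ℕ) : besselSeries ν 0 = 1 / (ν.factorial : ℝ) := by
  rw [besselSeries, tsum_eq_single 0 (fun k hk => by simp [hk])]
  simp

lemma besselI_eq (ν : ℕ) (x : ℝ) : besselI ν x = (x / 2) ^ ν * besselSeries ν ((x / 2) ^ 2) := by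
  rw [besselI, besselSeries, ← tsum_mul_left]
  congr 1 with k
  rw [pow_add, pow_mul]
  ring

lemma continuous_ncPdf (ν : ℕ) : Continuous fun p : ℝ × ℝ => ncPdf ν p.1 p.2 := by
  unfold ncPdf
  have := continuous_besselSeries ν
  fun_prop

lemma ncPdf_nonneg (ν : ℕ) {w u : ℝ} (hw : 0 ≤ w) (hu : 0 ≤ u) : 0 ≤ ncPdf ν w u := by
  have := besselSeries_nonneg ν (mul_nonneg hw hu)
  unfold ncPdf
  positivity

lemma integrableOn_pow_mul_exp_neg_mul (n : ℕ) {r : ℝ} (hr : 0 < r) :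
    IntegrableOn (fun x : ℝ => x ^ n * Real.exp (-(r * x))) (Ioi 0) := by
  have h := integrableOn_rpow_mul_exp_neg_mul_rpow (s := n) (p := 1) (b := r)
    (by have : (0 : ℝ) ≤ n := n.cast_nonneg
        linarith) one_pos hr
  simpa [neg_mul] using h

lemma integrableOn_pow_mul_cexp_neg_mul (n : ℕ) {r : ℂ} (hr : 0 < r.re) :
    IntegrableOn (fun x : ℝ => (x : ℂ) ^ n * Complex.exp (-(r * x))) (Ioi 0) := by
  refine (integrableOn_pow_mul_exp_neg_mul n hr).mono' (by fun_prop) ?_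
  filter_upwards [ae_restrict_mem measurableSet_Ioi] with x hx
  rw [norm_mul, norm_pow, Complex.norm_exp, Complex.norm_real, Real.norm_of_nonneg (le_of_lt hx)]
  simp

lemma integral_pow_mul_cexp_neg_mul (n : ℕ) {r : ℂ} (hr : 0 < r.re) :
    ∫ x in Ioi (0 : ℝ), (x : ℂ) ^ n * Complex.exp (-(r * x)) = (n.factorial : ℂ) / r ^ (n + 1) := by
  have hr0 : r ≠ 0 := by rintro rfl; simp at hr
  have hexp (x : ℝ) : HasDerivAt (fun x : ℝ => Complex.exp (-(r * x)))
      (-r * Complex.exp (-(r * x))) x := by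
    have h1 : HasDerivAt (fun x : ℝ => -(r * (x : ℂ))) (-(r * 1)) x :=
      ((Complex.ofRealCLM.hasDerivAt (x := x)).const_mul r).neg
    convert h1.cexp using 1
    ring
  have htend (k : ℕ) : Filter.Tendsto (fun x : ℝ => (x : ℂ) ^ k * Complex.exp (-(r * x)))
      Filter.atTop (nhds 0) := by
    rw [tendsto_zero_iff_norm_tendsto_zero]
    have h := tendsto_rpow_mul_exp_neg_mul_atTop_nhds_zero k r.re hr
    refine h.congr' ?_
    filter_upwards [Filter.eventually_ge_atTop 0] with x hx
    rw [norm_mul, norm_pow, Complex.norm_exp, Complex.norm_real, Real.norm_of_nonneg hx]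
    simp
  induction n with
  | zero =>
    have h := integral_Ioi_of_hasDerivAt_of_tendsto'
      (f := fun x : ℝ => -r⁻¹ * ((x : ℂ) ^ 0 * Complex.exp (-(r * x))))
      (f' := fun x : ℝ => (x : ℂ) ^ 0 * Complex.exp (-(r * x))) (a := 0) (m := 0)
      (fun x _ => by
        simp only [pow_zero, one_mul]
        exact ((hexp x).const_mul (-r⁻¹)).congr_deriv (by field_simp))
      (integrableOn_pow_mul_cexp_neg_mul 0 hr)
      (by simpa using (htend 0).const_mul (-r⁻¹))
    rw [h]
    simp
  | succ n ih =>
    have h := integral_Ioi_of_hasDerivAt_of_tendsto'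
      (f := fun x : ℝ => (x : ℂ) ^ (n + 1) * Complex.exp (-(r * x)))
      (f' := fun x : ℝ => ((n : ℂ) + 1) * ((x : ℂ) ^ n * Complex.exp (-(r * x)))
        - r * ((x : ℂ) ^ (n + 1) * Complex.exp (-(r * x)))) (a := 0) (m := 0)
      (fun x _ => by
        have h2 : HasDerivAt (fun x : ℝ => (x : ℂ) ^ (n + 1))
            (((n + 1 : ℕ) : ℂ) * (x : ℂ) ^ n * 1) x :=
          (Complex.ofRealCLM.hasDerivAt (x := x)).pow (n + 1)
        exact (h2.mul (hexp x)).congr_deriv (by push_cast; ring))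
      (((integrableOn_pow_mul_cexp_neg_mul n hr).const_mul _).sub
        ((integrableOn_pow_mul_cexp_neg_mul (n + 1) hr).const_mul _))
      (htend (n + 1))
    rw [integral_sub ((integrableOn_pow_mul_cexp_neg_mul n hr).const_mul _)
        ((integrableOn_pow_mul_cexp_neg_mul (n + 1) hr).const_mul _),
      integral_const_mul, integral_const_mul, ih] at h
    have h3 : r * ∫ x in Ioi (0 : ℝ), (x : ℂ) ^ (n + 1) * Complex.exp (-(r * x))
        = ((n : ℂ) + 1) * ((n.factorial : ℂ) / r ^ (n + 1)) := by
      simp at h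
      linear_combination -h
    rw [Nat.factorial_succ]
    push_cast
    field_simp at h3 ⊢
    linear_combination h3

lemma integral_pow_mul_exp_neg (n : ℕ) :
    ∫ x in Ioi (0 : ℝ), x ^ n * Real.exp (-x) = (n.factorial : ℝ) := by
  have h := integral_pow_mul_cexp_neg_mul n (r := 1) (by simp)
  rw [← Complex.ofReal_inj, ← integral_complex_ofReal]
  simpa using h

lemma integral_cexp_mul_ncPdf (ν : ℕ) {w : ℝ} (hw : 0 ≤ w) (t : ℝ) :
    ∫ u in Ioi (0 : ℝ), Complex.exp (t * u * Complex.I) * (ncPdf ν w u : ℂ)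
      = (1 - t * Complex.I)⁻¹ ^ (ν + 1)
        * Complex.exp (w * (t * Complex.I) / (1 - t * Complex.I)) := by
  set r : ℂ := 1 - t * Complex.I with hrdef
  have hr : 0 < r.re := by simp [hrdef]
  have hr0 : r ≠ 0 := by intro h; simp [h] at hr
  let c : ℕ → ℝ := fun k => Real.exp (-w) * w ^ k / ((k.factorial : ℝ) * ((k + ν).factorial : ℝ))
  let F : ℕ → ℝ → ℂ := fun k u => (c k : ℂ) * ((u : ℂ) ^ (k + ν) * Complex.exp (-(r * u)))
  have hF (k : ℕ) : Integrable (F k) (volume.restrict (Ioi 0)) :=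
    (integrableOn_pow_mul_cexp_neg_mul (k + ν) hr).const_mul _
  have hc (k : ℕ) : 0 ≤ c k := by positivity
  have hFn (k : ℕ) : ∫ u in Ioi (0 : ℝ), ‖F k u‖ = Real.exp (-w) * (w ^ k / (k.factorial : ℝ)) := by
    have : ∀ u ∈ Ioi (0 : ℝ), ‖F k u‖ = c k * (u ^ (k + ν) * Real.exp (-u)) := by
      intro u hu
      simp only [F]
      rw [norm_mul, norm_mul, norm_pow, Complex.norm_exp, Complex.norm_real, Complex.norm_real,
        Real.norm_of_nonneg (le_of_lt hu), Real.norm_of_nonneg (hc k)]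
      simp [hrdef]
    rw [setIntegral_congr_fun measurableSet_Ioi this, integral_const_mul,
      integral_pow_mul_exp_neg]
    simp only [c]
    field_simp
  have hsum : Summable fun k => ∫ u in Ioi (0 : ℝ), ‖F k u‖ := by
    simp_rw [hFn]
    exact (Real.summable_pow_div_factorial w).mul_left _
  have hmain := hasSum_integral_of_summable_integral_norm hF hsum
  have hval (k : ℕ) : ∫ u in Ioi (0 : ℝ), F k u
      = Complex.exp (-w) * r⁻¹ ^ (ν + 1) * ((w / r) ^ k / (k.factorial : ℂ)) := by
    simp only [F, c]
    rw [integral_const_mul, integral_pow_mul_cexp_neg_mul _ hr]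
    have h1 : ((k + ν).factorial : ℂ) ≠ 0 := by exact_mod_cast (Nat.factorial_ne_zero _)
    have h2 : (k.factorial : ℂ) ≠ 0 := by exact_mod_cast (Nat.factorial_ne_zero _)
    push_cast
    rw [inv_pow, div_pow, pow_succ, pow_add, pow_succ]
    clear_value r
    field_simp
  have hexp : HasSum (fun k => ∫ u in Ioi (0 : ℝ), F k u)
      (Complex.exp (-w) * r⁻¹ ^ (ν + 1) * Complex.exp (w / r)) := by
    simp_rw [hval]
    have h := NormedSpace.expSeries_div_hasSum_exp (w / r : ℂ)
    rw [← Complex.exp_eq_exp_ℂ] at h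
    exact h.mul_left _
  have heq := hmain.unique hexp
  have hfun (u : ℝ) : Complex.exp (t * u * Complex.I) * (ncPdf ν w u : ℂ) = ∑' k, F k u := by
    simp only [F, c, ncPdf, besselSeries]
    push_cast
    rw [← tsum_mul_left, ← tsum_mul_left]
    congr 1 with k
    have : Complex.exp (-(r * u)) = Complex.exp (t * u * Complex.I) * Complex.exp (-u) := by
      rw [← Complex.exp_add, hrdef]; ring_nf
    rw [this, neg_add, Complex.exp_add, pow_add, mul_pow]
    ring
  simp_rw [hfun]
  rw [heq, mul_comm (Complex.exp _), mul_assoc, ← Complex.exp_add]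
  congr 2
  rw [hrdef] at hr0 ⊢
  field_simp
  ring

lemma integral_ncPdf (ν : ℕ) {w : ℝ} (hw : 0 ≤ w) : ∫ u in Ioi (0 : ℝ), ncPdf ν w u = 1 := by
  have h := integral_cexp_mul_ncPdf ν hw 0
  rw [← Complex.ofReal_inj, ← integral_complex_ofReal]
  simpa using h

lemma integrableOn_ncPdf (ν : ℕ) {w : ℝ} (hw : 0 ≤ w) : IntegrableOn (ncPdf ν w) (Ioi 0) := by
  by_contra h
  have h1 := integral_ncPdf ν hw
  rw [integral_undef h] at h1
  exact zero_ne_one h1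

lemma marcumQ_eq_setIntegral_ncPdf (m : ℕ) (hm : 1 ≤ m) {a b : ℝ} (ha : 0 ≤ a) (hb : 0 ≤ b) :
    marcumQ m a b = ∫ u in Ioi (b ^ 2 / 2), ncPdf (m - 1) (a ^ 2 / 2) u := by
  obtain ⟨ν, rfl⟩ : ∃ ν, m = ν + 1 := ⟨m - 1, by omega⟩
  simp only [add_tsub_cancel_right]
  rcases ha.eq_or_lt with rfl | ha
  · rw [marcumQ, if_pos rfl, ← integral_div]
    refine setIntegral_congr_fun measurableSet_Ioi fun u _ => ?_
    simp only [ncPdf]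
    push_cast
    rw [Real.Gamma_nat_eq_factorial]
    simp [besselSeries_zero]
    ring
  · rw [marcumQ, if_neg ha.ne']
    have himg : (fun t : ℝ => t ^ 2 / 2) '' Ioi b = Ioi (b ^ 2 / 2) := by
      ext u
      simp only [mem_image, mem_Ioi]
      constructor
      · rintro ⟨t, ht, rfl⟩
        gcongr
      · intro hu
        refine ⟨√(2 * u), ?_, ?_⟩
        · apply Real.lt_sqrt_of_sq_lt
          linarith
        · have : 0 ≤ 2 * u := by nlinarith [sq_nonneg b]
          rw [Real.sq_sqrt this]
          ring
    have hinj : InjOn (fun t : ℝ => t ^ 2 / 2) (Ioi b) := by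
      intro s hs t ht hst
      have hs' : 0 ≤ s := hb.trans (le_of_lt hs)
      have ht' : 0 ≤ t := hb.trans (le_of_lt ht)
      have : s ^ 2 = t ^ 2 := by
        simp only at hst
        linarith
      exact (pow_left_inj₀ hs' ht' two_ne_zero).1 this
    have hder : ∀ t ∈ Ioi b, HasDerivWithinAt (fun t : ℝ => t ^ 2 / 2) t (Ioi b) t := by
      intro t _
      have := ((hasDerivAt_pow 2 t).div_const 2).hasDerivWithinAt (s := Ioi b)
      exact this.congr_deriv (by simp)
    rw [← himg, integral_image_eq_integral_abs_deriv_smul measurableSet_Ioi hder hinj]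
    refine setIntegral_congr_fun measurableSet_Ioi fun t ht => ?_
    have ht0 : 0 < t := hb.trans_lt ht
    simp only [ncPdf, smul_eq_mul, add_tsub_cancel_right]
    rw [abs_of_pos ht0, besselI_eq]
    have h1 : t * (t / a) ^ ν * Real.exp (-(t ^ 2 + a ^ 2) / 2)
        * ((a * t / 2) ^ ν * besselSeries ν ((a * t / 2) ^ 2))
        = t * ((t / a) * (a * t / 2)) ^ ν * Real.exp (-(t ^ 2 + a ^ 2) / 2)
          * besselSeries ν ((a * t / 2) ^ 2) := by
      rw [mul_pow (t / a)]
      ring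
    rw [h1]
    have h2 : t / a * (a * t / 2) = t ^ 2 / 2 := by
      field_simp
    have h3 : (a * t / 2) ^ 2 = a ^ 2 / 2 * (t ^ 2 / 2) := by ring
    have h4 : -(t ^ 2 + a ^ 2) / 2 = -(t ^ 2 / 2 + a ^ 2 / 2) := by ring
    rw [h2, h3, h4]
    ring

/-- The law with density `ncPdf ν w` on the positive half-line. -/
def ncMeasure (ν : ℕ) (w : ℝ) : Measure ℝ :=
  (volume.restrict (Ioi 0)).withDensity fun u => ENNReal.ofReal (ncPdf ν w u)

lemma measurable_ncPdf (ν : ℕ) (w : ℝ) : Measurable (ncPdf ν w) :=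
  (continuous_ncPdf ν).measurable.comp measurable_prodMk_left

lemma isProbabilityMeasure_ncMeasure (ν : ℕ) {w : ℝ} (hw : 0 ≤ w) :
    IsProbabilityMeasure (ncMeasure ν w) := by
  constructor
  rw [ncMeasure, withDensity_apply _ MeasurableSet.univ, Measure.restrict_univ,
    ← ofReal_integral_eq_lintegral_ofReal (integrableOn_ncPdf ν hw), integral_ncPdf ν hw]
  · simp
  · filter_upwards [ae_restrict_mem measurableSet_Ioi] with u hu
    exact ncPdf_nonneg ν hw (le_of_lt hu)

lemma charFun_ncMeasure (ν : ℕ) {w : ℝ} (hw : 0 ≤ w) (t : ℝ) :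
    charFun (ncMeasure ν w) t = (1 - t * Complex.I)⁻¹ ^ (ν + 1)
        * Complex.exp (w * (t * Complex.I) / (1 - t * Complex.I)) := by
  rw [charFun_apply_real, ← integral_cexp_mul_ncPdf ν hw t, ncMeasure,
    integral_withDensity_eq_integral_toReal_smul (measurable_ncPdf ν w).ennreal_ofReal (by simp)]
  refine setIntegral_congr_fun measurableSet_Ioi fun u hu => ?_
  rw [ENNReal.toReal_ofReal (ncPdf_nonneg ν hw (le_of_lt hu)), Complex.real_smul, mul_comm]

/-- The law of a real Gaussian variable with mean `0` and variance `1 / 2`. -/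
abbrev halfGaussian : Measure ℝ := gaussianReal 0 (1 / 2)

lemma integral_cexp_sq_halfGaussian (t a : ℝ) :
    ∫ x, Complex.exp (t * ((x + a) ^ 2 : ℝ) * Complex.I) ∂halfGaussian
      = ((√Real.pi : ℂ)⁻¹ * (Real.pi / (1 - t * Complex.I)) ^ (1 / 2 : ℂ))
        * Complex.exp ((a ^ 2 : ℝ) * (t * Complex.I) / (1 - t * Complex.I)) := by
  have hr0 : (1 - t * Complex.I : ℂ) ≠ 0 := by
    intro h
    have := congrArg Complex.re h
    simp at this
  rw [integral_gaussianReal_eq_integral_smul (by norm_num)]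
  have hpdf (x : ℝ) : gaussianPDFReal 0 (1 / 2) x • Complex.exp (t * ((x + a) ^ 2 : ℝ) * Complex.I)
      = (√Real.pi : ℂ)⁻¹ * Complex.exp (-(1 - t * Complex.I) * x ^ 2
        + (2 * t * a * Complex.I) * x + t * a ^ 2 * Complex.I) := by
    have hv : 2 * Real.pi * ((1 / 2 : NNReal) : ℝ) = Real.pi := by
      push_cast
      ring
    rw [gaussianPDFReal, Complex.real_smul, hv]
    push_cast
    rw [mul_assoc, ← Complex.exp_add]
    congr 2
    ring
  simp_rw [hpdf]
  rw [integral_const_mul, integral_cexp_quadratic (by simp), neg_neg, ← mul_assoc]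
  congr 2
  push_cast
  field_simp
  ring_nf

lemma gaussian_factor_sq (t : ℝ) :
    ((√Real.pi : ℂ)⁻¹ * (Real.pi / (1 - t * Complex.I)) ^ (1 / 2 : ℂ)) ^ 2
      = (1 - t * Complex.I)⁻¹ := by
  have hpi : (Real.pi : ℂ) ≠ 0 := by exact_mod_cast Real.pi_ne_zero
  rw [mul_pow, inv_pow, ← Complex.ofReal_pow, Real.sq_sqrt Real.pi_pos.le, ← Complex.cpow_nat_mul]
  norm_num
  field_simp

/-- The squared norm of a shifted Gaussian vector follows a noncentral chi-squared law. -/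
lemma map_sum_sq_halfGaussian {ι : Type*} [Fintype ι] (ν : ℕ) (hι : Fintype.card ι = 2 * (ν + 1))
    (a : ι → ℝ) :
    (Measure.pi fun _ : ι => halfGaussian).map (fun v => ∑ i, (v i + a i) ^ 2)
      = ncMeasure ν (∑ i, a i ^ 2) := by
  have hw : 0 ≤ ∑ i, a i ^ 2 := Finset.sum_nonneg fun i _ => sq_nonneg _
  have := isProbabilityMeasure_ncMeasure ν hw
  have hmeas : Measurable fun v : ι → ℝ => ∑ i, (v i + a i) ^ 2 := by fun_prop
  have := Measure.isProbabilityMeasure_map (μ := Measure.pi fun _ : ι => halfGaussian)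
    hmeas.aemeasurable
  refine Measure.ext_of_charFun (funext fun t => ?_)
  rw [charFun_ncMeasure ν hw, charFun_apply_real, integral_map hmeas.aemeasurable (by fun_prop)]
  have hprod (v : ι → ℝ) : Complex.exp (t * ((∑ i, (v i + a i) ^ 2 : ℝ) : ℂ) * Complex.I)
      = ∏ i, Complex.exp (t * ((v i + a i) ^ 2 : ℝ) * Complex.I) := by
    rw [← Complex.exp_sum]
    push_cast
    rw [Finset.mul_sum, Finset.sum_mul]
  simp_rw [hprod]
  rw [integral_fintype_prod_eq_prod
    (f := fun i x => Complex.exp (t * ((x + a i) ^ 2 : ℝ) * Complex.I))]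
  simp_rw [integral_cexp_sq_halfGaussian]
  rw [Finset.prod_mul_distrib, Finset.prod_const, Finset.card_univ, hι, pow_mul,
    gaussian_factor_sq, ← Complex.exp_sum]
  congr 2
  push_cast
  rw [Finset.sum_mul, Finset.sum_div]

/-- The density in `x > 0` of the squared norm of `√(1 - ρ²) v + ρ w` for a standard complex
Gaussian vector `v` and a vector `w` of squared norm `z`. -/
def shiftPdf (ν : ℕ) (ρ z x : ℝ) : ℝ :=
  1 / (1 - ρ ^ 2) * ncPdf ν (z * ρ ^ 2 / (1 - ρ ^ 2)) (x / (1 - ρ ^ 2))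

lemma one_sub_sq_pos {ρ : ℝ} (hρ : |ρ| < 1) : 0 < 1 - ρ ^ 2 := by
  have := (sq_lt_one_iff_abs_lt_one ρ).2 hρ
  linarith

lemma continuous_shiftPdf (ν : ℕ) (ρ : ℝ) :
    Continuous fun p : ℝ × ℝ => shiftPdf ν ρ p.1 p.2 := by
  unfold shiftPdf
  exact continuous_const.mul ((continuous_ncPdf ν).comp
    (f := fun p : ℝ × ℝ => (p.1 * ρ ^ 2 / (1 - ρ ^ 2), p.2 / (1 - ρ ^ 2))) (by fun_prop))

lemma shiftPdf_nonneg (ν : ℕ) {ρ z x : ℝ} (hρ : |ρ| < 1) (hz : 0 ≤ z) (hx : 0 ≤ x) :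
    0 ≤ shiftPdf ν ρ z x := by
  have hc := one_sub_sq_pos hρ
  exact mul_nonneg (by positivity) (ncPdf_nonneg ν (by positivity) (by positivity))

section Law

variable {ι : Type*} [Fintype ι]

/-- The law of a vector of independent real Gaussian variables of variance `1 / 2`. -/
abbrev gaussVec (ι : Type*) [Fintype ι] : Measure (ι → ℝ) := Measure.pi fun _ : ι => halfGaussian

lemma lintegral_comp_shift_sq_ncPdf {ν : ℕ} (hι : Fintype.card ι = 2 * (ν + 1)) {ρ : ℝ}
    (hρ : |ρ| < 1) (w : ι → ℝ) {F : ℝ → ENNReal} (hF : Measurable F) :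
    ∫⁻ v, F (∑ i, (√(1 - ρ ^ 2) * v i + ρ * w i) ^ 2) ∂gaussVec ι
      = ∫⁻ u in Ioi 0, ENNReal.ofReal (ncPdf ν ((∑ i, w i ^ 2) * ρ ^ 2 / (1 - ρ ^ 2)) u)
          * F ((1 - ρ ^ 2) * u) := by
  have hc := one_sub_sq_pos hρ
  set c := 1 - ρ ^ 2 with hcdef
  have hs : 0 < √c := Real.sqrt_pos.2 hc
  have h := map_sum_sq_halfGaussian ν hι fun i => ρ * w i / √c
  have hw : ∑ i, (ρ * w i / √c) ^ 2 = (∑ i, w i ^ 2) * ρ ^ 2 / c := by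
    rw [Finset.sum_mul, Finset.sum_div]
    refine Finset.sum_congr rfl fun i _ => ?_
    rw [div_pow, Real.sq_sqrt hc.le]
    ring
  rw [hw] at h
  have hscale (v : ι → ℝ) : ∑ i, (√c * v i + ρ * w i) ^ 2
      = c * ∑ i, (v i + ρ * w i / √c) ^ 2 := by
    rw [Finset.mul_sum]
    refine Finset.sum_congr rfl fun i _ => ?_
    have : √c * v i + ρ * w i = √c * (v i + ρ * w i / √c) := by
      field_simp
    rw [this, mul_pow, Real.sq_sqrt hc.le]
  simp_rw [hscale]
  have hFc : Measurable fun u => F (c * u) := by fun_prop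
  rw [← lintegral_map (f := fun u => F (c * u)) hFc (by fun_prop), h, ncMeasure,
    lintegral_withDensity_eq_lintegral_mul _ (measurable_ncPdf _ _).ennreal_ofReal hFc]
  rfl

lemma lintegral_comp_shift_sq {ν : ℕ} (hι : Fintype.card ι = 2 * (ν + 1)) {ρ : ℝ}
    (hρ : |ρ| < 1) (w : ι → ℝ) {F : ℝ → ENNReal} (hF : Measurable F) :
    ∫⁻ v, F (∑ i, (√(1 - ρ ^ 2) * v i + ρ * w i) ^ 2) ∂gaussVec ι
      = ∫⁻ x in Ioi 0, ENNReal.ofReal (shiftPdf ν ρ (∑ i, w i ^ 2) x) * F x := by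
  rw [lintegral_comp_shift_sq_ncPdf hι hρ w hF]
  have hc := one_sub_sq_pos hρ
  set c := 1 - ρ ^ 2 with hcdef
  have himg : (fun u : ℝ => c * u) '' Ioi 0 = Ioi 0 := by
    rw [image_mul_left_Ioi hc, mul_zero]
  conv_rhs => rw [← himg]
  rw [lintegral_image_eq_lintegral_abs_deriv_mul (f' := fun _ => c) measurableSet_Ioi
    (fun u _ => by simpa using ((hasDerivAt_id u).const_mul c).hasDerivWithinAt)
    (mul_right_injective₀ hc.ne').injOn]
  refine setLIntegral_congr_fun measurableSet_Ioi fun u hu => ?_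
  simp only [shiftPdf]
  rw [← hcdef, abs_of_pos hc, ← mul_assoc, ← ENNReal.ofReal_mul hc.le, ← mul_assoc,
    mul_one_div_cancel hc.ne', one_mul, mul_div_cancel_left₀ _ hc.ne']

lemma lintegral_comp_sq {ν : ℕ} (hι : Fintype.card ι = 2 * (ν + 1)) {F : ℝ → ENNReal}
    (hF : Measurable F) :
    ∫⁻ v, F (∑ i, v i ^ 2) ∂gaussVec ι = ∫⁻ z in Ioi 0, ENNReal.ofReal (ncPdf ν 0 z) * F z := by
  have h := lintegral_comp_shift_sq hι (ρ := 0) (by simp) 0 hF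
  simpa [shiftPdf] using h

lemma marcumQ_sqrt_eq (m : ℕ) (hm : 1 ≤ m) {a b : ℝ} (ha : 0 ≤ a) (hb : 0 ≤ b) :
    marcumQ m √(2 * a) √(2 * b) = ∫ u in Ioi b, ncPdf (m - 1) a u := by
  rw [marcumQ_eq_setIntegral_ncPdf m hm (Real.sqrt_nonneg _) (Real.sqrt_nonneg _),
    Real.sq_sqrt (by positivity), Real.sq_sqrt (by positivity)]
  simp

lemma marcumQ_nonneg (m : ℕ) (hm : 1 ≤ m) {a b : ℝ} (ha : 0 ≤ a) (hb : 0 ≤ b) :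
    0 ≤ marcumQ m a b := by
  rw [marcumQ_eq_setIntegral_ncPdf m hm ha hb]
  refine setIntegral_nonneg measurableSet_Ioi fun u hu => ?_
  have hu' : b ^ 2 / 2 < u := hu
  exact ncPdf_nonneg _ (by positivity) (by nlinarith [sq_nonneg b])

lemma marcumQ_le_one (m : ℕ) (hm : 1 ≤ m) {a b : ℝ} (ha : 0 ≤ a) (hb : 0 ≤ b) :
    marcumQ m a b ≤ 1 := by
  have hw : 0 ≤ a ^ 2 / 2 := by positivity
  rw [marcumQ_eq_setIntegral_ncPdf m hm ha hb, ← integral_ncPdf (m - 1) hw]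
  refine setIntegral_mono_set (integrableOn_ncPdf _ hw) ?_
    (Ioi_subset_Ioi (by positivity)).eventuallyLE
  filter_upwards [ae_restrict_mem measurableSet_Ioi] with u hu
  exact ncPdf_nonneg _ hw (le_of_lt hu)

lemma phi_nonneg (m : ℕ) (hm : 1 ≤ m) (ρ z x : ℝ) : 0 ≤ phi m ρ z x :=
  sub_nonneg.2 (marcumQ_le_one m hm (Real.sqrt_nonneg _) (Real.sqrt_nonneg _))

lemma measurable_marcumQ_comp {α : Type*} [MeasurableSpace α] (m : ℕ) (hm : 1 ≤ m) {f g : α → ℝ}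
    (hf : Measurable f) (hg : Measurable g) :
    Measurable fun p => marcumQ m √(f p) √(g p) := by
  have h (p : α) : marcumQ m √(f p) √(g p)
      = ∫ u, ({q : α × ℝ | √(g q.1) ^ 2 / 2 < q.2}.indicator
          (fun q => ncPdf (m - 1) (√(f q.1) ^ 2 / 2) q.2) (p, u)) := by
    rw [marcumQ_eq_setIntegral_ncPdf m hm (Real.sqrt_nonneg _) (Real.sqrt_nonneg _),
      ← integral_indicator measurableSet_Ioi]
    rfl
  simp_rw [h]
  refine (StronglyMeasurable.integral_prod_right' (Measurable.stronglyMeasurable ?_)).measurable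
  refine Measurable.indicator ?_ (measurableSet_lt (by fun_prop) (by fun_prop))
  exact (continuous_ncPdf (m - 1)).measurable.comp
    (f := fun q : α × ℝ => (√(f q.1) ^ 2 / 2, q.2)) (by fun_prop)

lemma measurable_phi (m : ℕ) (hm : 1 ≤ m) (ρ : ℝ) :
    Measurable fun p : ℝ × ℝ => phi m ρ p.1 p.2 := by
  unfold phi
  exact measurable_const.sub (measurable_marcumQ_comp m hm (by fun_prop) (by fun_prop))

lemma gaussVec_lt_shift_sq {m : ℕ} (hm : 1 ≤ m) (hι : Fintype.card ι = 2 * m) {ρ : ℝ}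
    (hρ : |ρ| < 1) (w : ι → ℝ) {r : ℝ} (hr : 0 ≤ r) :
    gaussVec ι {v | r < ∑ i, (√(1 - ρ ^ 2) * v i + ρ * w i) ^ 2}
      = ENNReal.ofReal (marcumQ m √(2 * (∑ i, w i ^ 2) * ρ ^ 2 / (1 - ρ ^ 2))
          √(2 * r / (1 - ρ ^ 2))) := by
  have hι' : Fintype.card ι = 2 * ((m - 1) + 1) := by omega
  have hc := one_sub_sq_pos hρ
  have hz : 0 ≤ ∑ i, w i ^ 2 := Finset.sum_nonneg fun i _ => sq_nonneg _
  have h := lintegral_comp_shift_sq_ncPdf hι' hρ w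
    (F := (Ioi r).indicator 1) (measurable_one.indicator measurableSet_Ioi)
  have hw : 0 ≤ (∑ i, w i ^ 2) * ρ ^ 2 / (1 - ρ ^ 2) := by positivity
  have hL : gaussVec ι {v | r < ∑ i, (√(1 - ρ ^ 2) * v i + ρ * w i) ^ 2}
      = ∫⁻ v, (Ioi r).indicator 1 (∑ i, (√(1 - ρ ^ 2) * v i + ρ * w i) ^ 2) ∂gaussVec ι := by
    rw [← lintegral_indicator_one (measurableSet_lt measurable_const (by fun_prop))]
    rfl
  rw [hL, h, mul_assoc 2, mul_div_assoc 2, mul_div_assoc 2, marcumQ_sqrt_eq m hm hw (by positivity),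
    ofReal_integral_eq_lintegral_ofReal
      ((integrableOn_ncPdf _ hw).mono_set (Ioi_subset_Ioi (by positivity)))
      (by
        filter_upwards [ae_restrict_mem measurableSet_Ioi] with u hu
        exact ncPdf_nonneg _ hw ((by positivity : 0 ≤ r / (1 - ρ ^ 2)).trans (le_of_lt hu))),
    ← lintegral_indicator measurableSet_Ioi, ← lintegral_indicator measurableSet_Ioi]
  congr 1 with u
  by_cases hu : r / (1 - ρ ^ 2) < u
  · have hu0 : 0 < u := (by positivity : 0 ≤ r / (1 - ρ ^ 2)).trans_lt hu
    have hu1 : r < (1 - ρ ^ 2) * u := by rwa [div_lt_iff₀' hc] at hu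
    simp [hu, hu0, hu1]
  · have hu1 : ¬ r < (1 - ρ ^ 2) * u := by rwa [div_lt_iff₀' hc] at hu
    simp [hu, hu1]

lemma gaussVec_shift_sq_le {m : ℕ} (hm : 1 ≤ m) (hι : Fintype.card ι = 2 * m) {ρ : ℝ}
    (hρ : |ρ| < 1) (w : ι → ℝ) {r : ℝ} (hr : 0 ≤ r) :
    gaussVec ι {v | ∑ i, (√(1 - ρ ^ 2) * v i + ρ * w i) ^ 2 ≤ r}
      = ENNReal.ofReal (phi m ρ (∑ i, w i ^ 2) r) := by
  have hset : {v : ι → ℝ | ∑ i, (√(1 - ρ ^ 2) * v i + ρ * w i) ^ 2 ≤ r}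
      = {v | r < ∑ i, (√(1 - ρ ^ 2) * v i + ρ * w i) ^ 2}ᶜ := by
    ext v
    simp
  rw [hset, prob_compl_eq_one_sub (measurableSet_lt measurable_const (by fun_prop)),
    gaussVec_lt_shift_sq hm hι hρ w hr, phi, ENNReal.ofReal_sub _
      (marcumQ_nonneg m hm (Real.sqrt_nonneg _) (Real.sqrt_nonneg _)), ENNReal.ofReal_one]

lemma gaussVec_shift_sq_eq {m : ℕ} (hm : 1 ≤ m) (hι : Fintype.card ι = 2 * m) {ρ : ℝ}
    (hρ : |ρ| < 1) (w : ι → ℝ) (r : ℝ) :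
    gaussVec ι {v | ∑ i, (√(1 - ρ ^ 2) * v i + ρ * w i) ^ 2 = r} = 0 := by
  have hι' : Fintype.card ι = 2 * ((m - 1) + 1) := by omega
  have h := lintegral_comp_shift_sq hι' hρ w (F := ({r} : Set ℝ).indicator 1)
    (measurable_one.indicator (measurableSet_singleton r))
  have hL : gaussVec ι {v | ∑ i, (√(1 - ρ ^ 2) * v i + ρ * w i) ^ 2 = r}
      = ∫⁻ v, ({r} : Set ℝ).indicator 1 (∑ i, (√(1 - ρ ^ 2) * v i + ρ * w i) ^ 2) ∂gaussVec ι := by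
    rw [← lintegral_indicator_one (measurableSet_eq_fun (by fun_prop) measurable_const)]
    rfl
  rw [hL, h]
  have hae : ∀ᵐ x ∂(volume.restrict (Ioi (0 : ℝ))), x ≠ r :=
    ae_restrict_of_ae (by simp [ae_iff])
  rw [lintegral_congr_ae (g := fun _ => 0) (by
    filter_upwards [hae] with x hx
    simp [hx])]
  simp

end Law

lemma exp_mul_besselFactor_eq (m : ℕ) (hm : 1 ≤ m) {ρ x z : ℝ} (hρ : |ρ| < 1) (hx : 0 < x)
    (hz : 0 < z) :
    1 / (Real.Gamma m * (1 - ρ ^ 2)) * (Real.exp (-((x + z) / (1 - ρ ^ 2))) * besselFactor m ρ x z)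
      = ncPdf (m - 1) 0 z * shiftPdf (m - 1) ρ z x := by
  obtain ⟨ν, rfl⟩ : ∃ ν, m = ν + 1 := ⟨m - 1, by omega⟩
  have hc := one_sub_sq_pos hρ
  simp only [ncPdf, shiftPdf, besselFactor, add_tsub_cancel_right]
  push_cast
  rw [Real.Gamma_nat_eq_factorial, zero_mul, besselSeries_zero]
  have hfac : (ν.factorial : ℝ) ≠ 0 := by exact_mod_cast (Nat.factorial_ne_zero _)
  split_ifs with h0
  · subst h0
    simp [besselSeries_zero, mul_pow]
    rw [add_comm, Real.exp_add]
    field_simp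
  · have hρ2 : 0 < ρ ^ 2 := by positivity
    rw [besselI_eq]
    have h1 : (x * z / ρ ^ 2) ^ (((ν : ℝ) + 1 - 1) / 2) = √(x * z / ρ ^ 2) ^ ν := by
      rw [Real.sqrt_eq_rpow, ← Real.rpow_natCast _ ν, ← Real.rpow_mul (by positivity)]
      congr 1
      ring
    have h2 : 2 * √(x * z * ρ ^ 2) / (1 - ρ ^ 2) / 2 = √(x * z * ρ ^ 2) / (1 - ρ ^ 2) := by ring
    have h3 : √(x * z / ρ ^ 2) * √(x * z * ρ ^ 2) = x * z := by
      rw [← Real.sqrt_mul (by positivity)]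
      have : x * z / ρ ^ 2 * (x * z * ρ ^ 2) = (x * z) ^ 2 := by field_simp
      rw [this, Real.sqrt_sq (by positivity)]
    have h4 : (√(x * z * ρ ^ 2) / (1 - ρ ^ 2)) ^ 2
        = z * ρ ^ 2 / (1 - ρ ^ 2) * (x / (1 - ρ ^ 2)) := by
      rw [div_pow, Real.sq_sqrt (by positivity)]
      field_simp
    have h5 : Real.exp (-((x + z) / (1 - ρ ^ 2)))
        = Real.exp (-(z + 0)) * Real.exp (-(x / (1 - ρ ^ 2) + z * ρ ^ 2 / (1 - ρ ^ 2))) := by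
      rw [← Real.exp_add]
      congr 1
      field_simp
      ring
    have h6 : √(x * z / ρ ^ 2) ^ ν * (√(x * z * ρ ^ 2) / (1 - ρ ^ 2)) ^ ν
        = z ^ ν * (x / (1 - ρ ^ 2)) ^ ν := by
      rw [← mul_pow, ← mul_div_assoc, h3, ← mul_pow]
      congr 1
      ring
    rw [h1, h2, h4, h5, ← mul_assoc (√(x * z / ρ ^ 2) ^ ν), h6]
    field_simp

section Density

variable {N : ℕ} [NeZero N]

/-- The conditional probability that no port other than `0` and `n` exceeds the level `x`, given
that port `0` has gain `z`. -/
def othersBelow (m : ℕ) (ρ : Fin N → ℝ) (n : Fin N) (p : ℝ × ℝ) : ENNReal :=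
  ∏ k ∈ (Finset.univ.erase (0 : Fin N)).erase n, ENNReal.ofReal (phi m (ρ k) p.1 p.2)

lemma measurable_othersBelow {m : ℕ} (hm : 1 ≤ m) (ρ : Fin N → ℝ) (n : Fin N) :
    Measurable (othersBelow m ρ n) := by
  unfold othersBelow
  exact Finset.measurable_prod _ fun k _ => (measurable_phi m hm (ρ k)).ennreal_ofReal

/-- The extended-real form of the density `selPdf`. -/
def selDens (m : ℕ) (ρ : Fin N → ℝ) (n : Fin N) (x : ℝ) : ENNReal :=
  if n = 0 then ENNReal.ofReal (ncPdf (m - 1) 0 x) * othersBelow m ρ 0 (x, x)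
  else ∫⁻ z in Ioi 0, ENNReal.ofReal (ncPdf (m - 1) 0 z)
    * (ENNReal.ofReal (shiftPdf (m - 1) (ρ n) z x)
      * ({p : ℝ × ℝ | p.1 ≤ p.2}.indicator (othersBelow m ρ n) (z, x)))

lemma measurable_joint {m : ℕ} (hm : 1 ≤ m) (ρ : Fin N → ℝ) (n : Fin N) :
    Measurable fun p : ℝ × ℝ => ENNReal.ofReal (ncPdf (m - 1) 0 p.1)
      * (ENNReal.ofReal (shiftPdf (m - 1) (ρ n) p.1 p.2)
        * ({p : ℝ × ℝ | p.1 ≤ p.2}.indicator (othersBelow m ρ n) p)) := by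
  refine ((measurable_ncPdf _ _).comp measurable_fst).ennreal_ofReal.mul
    ((continuous_shiftPdf _ _).measurable.ennreal_ofReal.mul ?_)
  exact (measurable_othersBelow hm ρ n).indicator (measurableSet_le measurable_fst measurable_snd)

lemma measurable_selDens {m : ℕ} (hm : 1 ≤ m) (ρ : Fin N → ℝ) (n : Fin N) :
    Measurable (selDens m ρ n) := by
  unfold selDens
  split_ifs with h
  · exact (measurable_ncPdf _ _).ennreal_ofReal.mul
      ((measurable_othersBelow hm ρ 0).comp (measurable_id.prodMk measurable_id))
  · exact (measurable_joint hm ρ n).lintegral_prod_left'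

lemma selPdf_nonneg {m : ℕ} (hm : 1 ≤ m) {ρ : Fin N → ℝ} (hρ : ∀ n, n ≠ 0 → |ρ n| < 1)
    (n : Fin N) {x : ℝ} (hx : 0 < x) : 0 ≤ selPdf m ρ n x := by
  have hΓ : 0 < Real.Gamma m := Real.Gamma_pos_of_pos (by exact_mod_cast hm)
  unfold selPdf
  split_ifs with h
  · exact mul_nonneg (by positivity) (Finset.prod_nonneg fun k _ => phi_nonneg m hm _ _ _)
  · have hc := one_sub_sq_pos (hρ n h)
    rw [intervalIntegral.integral_of_le hx.le, ← integral_const_mul]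
    refine setIntegral_nonneg measurableSet_Ioc fun z hz => ?_
    rw [← mul_assoc, exp_mul_besselFactor_eq m hm (hρ n h) hx hz.1]
    exact mul_nonneg (mul_nonneg (ncPdf_nonneg _ le_rfl hz.1.le)
      (shiftPdf_nonneg _ (hρ n h) hz.1.le hx.le))
      (Finset.prod_nonneg fun k _ => phi_nonneg m hm _ _ _)

lemma ofReal_selPdf {m : ℕ} (hm : 1 ≤ m) {ρ : Fin N → ℝ} (hρ : ∀ n, n ≠ 0 → |ρ n| < 1)
    (n : Fin N) {x : ℝ} (hx : 0 < x) : ENNReal.ofReal (selPdf m ρ n x) = selDens m ρ n x := by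
  unfold selPdf selDens
  split_ifs with h
  · have hpdf : 1 / Real.Gamma m * Real.exp (-x) * x ^ (m - 1) = ncPdf (m - 1) 0 x := by
      obtain ⟨ν, rfl⟩ : ∃ ν, m = ν + 1 := ⟨m - 1, by omega⟩
      simp only [ncPdf, add_tsub_cancel_right, zero_mul, besselSeries_zero, add_zero]
      push_cast
      rw [Real.Gamma_nat_eq_factorial]
      ring
    rw [hpdf, ENNReal.ofReal_mul (ncPdf_nonneg _ le_rfl hx.le), othersBelow,
      ENNReal.ofReal_prod_of_nonneg fun k _ => phi_nonneg m hm _ _ _]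
    simp
  · have hρn := hρ n h
    rw [intervalIntegral.integral_of_le hx.le, ← integral_const_mul]
    have hcongr : ∀ z ∈ Ioc 0 x, 1 / (Real.Gamma m * (1 - ρ n ^ 2)) *
        (Real.exp (-((x + z) / (1 - ρ n ^ 2))) * besselFactor m (ρ n) x z
          * ∏ k ∈ (Finset.univ.erase (0 : Fin N)).erase n, phi m (ρ k) z x)
        = ncPdf (m - 1) 0 z * shiftPdf (m - 1) (ρ n) z x
          * ∏ k ∈ (Finset.univ.erase (0 : Fin N)).erase n, phi m (ρ k) z x := fun z hz => by
      rw [← mul_assoc, exp_mul_besselFactor_eq m hm hρn hx hz.1]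
    rw [setIntegral_congr_fun measurableSet_Ioc hcongr]
    have hcont : Continuous fun z : ℝ => ncPdf (m - 1) 0 z * shiftPdf (m - 1) (ρ n) z x :=
      ((continuous_ncPdf _).comp (f := fun z : ℝ => ((0 : ℝ), z)) (by fun_prop)).mul
        ((continuous_shiftPdf _ _).comp (f := fun z : ℝ => (z, x)) (by fun_prop))
    have hprod_meas : Measurable fun z : ℝ =>
        ∏ k ∈ (Finset.univ.erase (0 : Fin N)).erase n, phi m (ρ k) z x :=
      Finset.measurable_prod _ fun k _ => (measurable_phi m hm (ρ k)).comp measurable_prodMk_right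
    have hint : IntegrableOn (fun z : ℝ => ncPdf (m - 1) 0 z * shiftPdf (m - 1) (ρ n) z x
          * ∏ k ∈ (Finset.univ.erase (0 : Fin N)).erase n, phi m (ρ k) z x) (Ioc 0 x) := by
      have h0 : IntegrableOn (fun z : ℝ => ncPdf (m - 1) 0 z * shiftPdf (m - 1) (ρ n) z x)
          (Ioc 0 x) := hcont.integrableOn_Ioc
      refine h0.mul_bdd (c := 1) hprod_meas.aestronglyMeasurable (ae_of_all _ fun z => ?_)
      rw [Real.norm_of_nonneg (Finset.prod_nonneg fun k _ => phi_nonneg m hm _ _ _)]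
      exact Finset.prod_le_one (fun k _ => phi_nonneg m hm _ _ _) fun k _ =>
        sub_le_self _ (marcumQ_nonneg m hm (Real.sqrt_nonneg _) (Real.sqrt_nonneg _))
    rw [ofReal_integral_eq_lintegral_ofReal hint]
    · rw [← lintegral_indicator measurableSet_Ioc, ← lintegral_indicator measurableSet_Ioi]
      congr 1 with z
      by_cases hz : z ∈ Ioc 0 x
      · have hz1 : z ∈ Ioi (0 : ℝ) := hz.1
        have hz2 : (z, x) ∈ {p : ℝ × ℝ | p.1 ≤ p.2} := hz.2
        have hn1 := ncPdf_nonneg (m - 1) le_rfl hz.1.le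
        have hn2 := shiftPdf_nonneg (m - 1) hρn hz.1.le hx.le
        rw [indicator_of_mem hz, indicator_of_mem hz1, indicator_of_mem hz2,
          ENNReal.ofReal_mul (mul_nonneg hn1 hn2), ENNReal.ofReal_mul hn1, othersBelow,
          ENNReal.ofReal_prod_of_nonneg fun k _ => phi_nonneg m hm _ _ _, mul_assoc]
      · rw [indicator_of_notMem hz]
        by_cases hz1 : z ∈ Ioi (0 : ℝ)
        · have hz2 : (z, x) ∉ {p : ℝ × ℝ | p.1 ≤ p.2} := fun h => hz ⟨hz1, h⟩
          rw [indicator_of_mem hz1, indicator_of_notMem hz2]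
          simp
        · rw [indicator_of_notMem hz1]
    · filter_upwards [ae_restrict_mem measurableSet_Ioc] with z hz
      exact mul_nonneg (mul_nonneg (ncPdf_nonneg _ le_rfl hz.1.le)
        (shiftPdf_nonneg _ hρn hz.1.le hx.le))
        (Finset.prod_nonneg fun k _ => phi_nonneg m hm _ _ _)

lemma aemeasurable_selPdf {m : ℕ} (hm : 1 ≤ m) {ρ : Fin N → ℝ} (hρ : ∀ n, n ≠ 0 → |ρ n| < 1)
    (n : Fin N) : AEMeasurable (selPdf m ρ n) (volume.restrict (Ioi 0)) := by
  refine ⟨fun x => (selDens m ρ n x).toReal, (measurable_selDens hm ρ n).ennreal_toReal, ?_⟩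
  filter_upwards [ae_restrict_mem measurableSet_Ioi] with x hx
  rw [← ofReal_selPdf hm hρ n hx, ENNReal.toReal_ofReal (selPdf_nonneg hm hρ n hx)]

end Density

section Independence

variable {Ω : Type*} [MeasurableSpace Ω] {P : Measure Ω} [IsProbabilityMeasure P]

lemma lintegral_comp_of_indepFun {α β : Type*} [MeasurableSpace α] [MeasurableSpace β]
    {Z : Ω → α} {Y : Ω → β} {κ : Measure β} [SFinite κ] (hZ : AEMeasurable Z P) (hY : HasLaw Y κ P)
    (hZY : IndepFun Z Y P) {F : α × β → ENNReal} (hF : Measurable F) :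
    ∫⁻ ω, F (Z ω, Y ω) ∂P = ∫⁻ ω, ∫⁻ y, F (Z ω, y) ∂κ ∂P := by
  rw [← lintegral_map' (f := F) (g := fun ω => (Z ω, Y ω)) hF.aemeasurable
      (hZ.prodMk hY.aemeasurable),
    (indepFun_iff_map_prod_eq_prod_map_map hZ hY.aemeasurable).1 hZY, hY.map_eq,
    lintegral_prod _ hF.aemeasurable, lintegral_map' hF.lintegral_prod_right'.aemeasurable hZ]

lemma measure_mem_of_indepFun {α β : Type*} [MeasurableSpace α] [MeasurableSpace β]
    {Z : Ω → α} {Y : Ω → β} {κ : Measure β} [SFinite κ] (hZ : AEMeasurable Z P) (hY : HasLaw Y κ P)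
    (hZY : IndepFun Z Y P) {D : Set (α × β)} (hD : MeasurableSet D) :
    P {ω | (Z ω, Y ω) ∈ D} = ∫⁻ ω, κ {y | (Z ω, y) ∈ D} ∂P := by
  have h := lintegral_comp_of_indepFun hZ hY hZY (measurable_one.indicator hD)
  have hL : P {ω | (Z ω, Y ω) ∈ D} = ∫⁻ ω, D.indicator 1 (Z ω, Y ω) ∂P :=
    (lintegral_indicator_one₀
      ((hZ.prodMk hY.aemeasurable).nullMeasurableSet_preimage hD)).symm
  rw [hL, h]
  congr 1 with ω
  exact lintegral_indicator_one (measurable_prodMk_left hD)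

end Independence

section Gain

variable {N : ℕ} [NeZero N] {ι : Type*} [Fintype ι]

/-- The vector of real and imaginary parts of the estimated channels of port `n`, as a function
of the underlying independent Gaussian vectors. -/
def estVec (ρ : Fin N → ℝ) (w : Fin N → ι → ℝ) (n : Fin N) : ι → ℝ :=
  if n = 0 then w 0 else fun i => √(1 - ρ n ^ 2) * w n i + ρ n * w 0 i

/-- The squared norm of `estVec`. -/
def vecGain (ρ : Fin N → ℝ) (w : Fin N → ι → ℝ) (n : Fin N) : ℝ := ∑ i, estVec ρ w n i ^ 2

lemma vecGain_zero (ρ : Fin N → ℝ) (w : Fin N → ι → ℝ) : vecGain ρ w 0 = ∑ i, w 0 i ^ 2 := by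
  simp [vecGain, estVec]

lemma vecGain_of_ne (ρ : Fin N → ℝ) (w : Fin N → ι → ℝ) {n : Fin N} (hn : n ≠ 0) :
    vecGain ρ w n = ∑ i, (√(1 - ρ n ^ 2) * w n i + ρ n * w 0 i) ^ 2 := by
  simp [vecGain, estVec, hn]

lemma vecGain_nonneg (ρ : Fin N → ℝ) (w : Fin N → ι → ℝ) (n : Fin N) : 0 ≤ vecGain ρ w n :=
  Finset.sum_nonneg fun _ _ => sq_nonneg _

lemma measurable_estVec {ι : Type*} (ρ : Fin N → ℝ) (n : Fin N) :
    Measurable fun w : Fin N → ι → ℝ => estVec ρ w n := by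
  unfold estVec
  split_ifs <;> fun_prop

lemma measurable_vecGain (ρ : Fin N → ℝ) (n : Fin N) :
    Measurable fun w : Fin N → ι → ℝ => vecGain ρ w n := by
  have := measurable_estVec (ι := ι) ρ n
  unfold vecGain
  fun_prop

/-- The gain of port `n` as a function of the Gaussian vectors of ports `0` and `n`. -/
def pairGain (ρ : Fin N → ℝ) (n : Fin N) (p : (ι → ℝ) × (ι → ℝ)) : ℝ :=
  if n = 0 then ∑ i, p.1 i ^ 2 else ∑ i, (√(1 - ρ n ^ 2) * p.2 i + ρ n * p.1 i) ^ 2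

lemma measurable_pairGain (ρ : Fin N → ℝ) (n : Fin N) :
    Measurable (pairGain (ι := ι) ρ n) := by
  unfold pairGain
  split_ifs <;> fun_prop

lemma pairGain_eq (ρ : Fin N → ℝ) (w : Fin N → ι → ℝ) (n : Fin N) :
    pairGain ρ n (w 0, w n) = vecGain ρ w n := by
  by_cases hn : n = 0
  · subst hn
    simp [pairGain, vecGain_zero]
  · simp [pairGain, vecGain_of_ne _ _ hn, hn]

variable {Ω : Type*} [MeasurableSpace Ω] {P : Measure Ω} [IsProbabilityMeasure P]
  {m : ℕ} {ρ : Fin N → ℝ} {W : Fin N → Ω → ι → ℝ}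

lemma measure_vecGain_eq_zero_of_ne_zero (hm : 1 ≤ m) (hι : Fintype.card ι = 2 * m)
    (hρ : ∀ n, n ≠ 0 → |ρ n| < 1) (hW : iIndepFun W P) (hlaw : ∀ n, HasLaw (W n) (gaussVec ι) P)
    {j n : Fin N} (hj : j ≠ 0) (hjn : j ≠ n) :
    P {ω | vecGain ρ (fun k => W k ω) j = vecGain ρ (fun k => W k ω) n} = 0 := by
  have hind := hW.indepFun_prodMk₀ (fun k => (hlaw k).aemeasurable) 0 n j hj.symm hjn.symm
  have hD : MeasurableSet {q : ((ι → ℝ) × (ι → ℝ)) × (ι → ℝ) |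
      ∑ i, (√(1 - ρ j ^ 2) * q.2 i + ρ j * q.1.1 i) ^ 2 = pairGain ρ n q.1} :=
    measurableSet_eq_fun (by fun_prop) ((measurable_pairGain ρ n).comp measurable_fst)
  have h := measure_mem_of_indepFun
    ((hlaw 0).aemeasurable.prodMk (hlaw n).aemeasurable) (hlaw j) hind hD
  have hset : {ω | vecGain ρ (fun k => W k ω) j = vecGain ρ (fun k => W k ω) n}
      = {ω | ((W 0 ω, W n ω), W j ω) ∈ {q : ((ι → ℝ) × (ι → ℝ)) × (ι → ℝ) |
          ∑ i, (√(1 - ρ j ^ 2) * q.2 i + ρ j * q.1.1 i) ^ 2 = pairGain ρ n q.1}} := by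
    ext ω
    simp only [mem_ofPred_eq]
    rw [vecGain_of_ne _ _ hj, ← pairGain_eq ρ (fun k => W k ω) n]
  rw [hset, h]
  simp only [mem_ofPred_eq, gaussVec_shift_sq_eq hm hι (hρ j hj), lintegral_zero]

lemma measure_vecGain_eq_zero (hm : 1 ≤ m) (hι : Fintype.card ι = 2 * m)
    (hρ : ∀ n, n ≠ 0 → |ρ n| < 1) (hW : iIndepFun W P) (hlaw : ∀ n, HasLaw (W n) (gaussVec ι) P)
    {j n : Fin N} (hjn : j ≠ n) :
    P {ω | vecGain ρ (fun k => W k ω) j = vecGain ρ (fun k => W k ω) n} = 0 := by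
  by_cases hj : j = 0
  · have hn : n ≠ 0 := by rintro rfl; exact hjn hj
    simpa [eq_comm] using measure_vecGain_eq_zero_of_ne_zero hm hι hρ hW hlaw hn hjn.symm
  · exact measure_vecGain_eq_zero_of_ne_zero hm hι hρ hW hlaw hj hjn

/-- Up to a null set, a maximizing index equals `n` exactly when port `n` has the largest gain. -/
lemma selection_ae_eq (hm : 1 ≤ m) (hι : Fintype.card ι = 2 * m)
    (hρ : ∀ n, n ≠ 0 → |ρ n| < 1) (hW : iIndepFun W P) (hlaw : ∀ n, HasLaw (W n) (gaussVec ι) P)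
    {s : Ω → Fin N}
    (hs : ∀ ω n, vecGain ρ (fun k => W k ω) n ≤ vecGain ρ (fun k => W k ω) (s ω)) (n : Fin N) :
    {ω | s ω = n}
      =ᵐ[P] {ω | ∀ k, vecGain ρ (fun k => W k ω) k ≤ vecGain ρ (fun k => W k ω) n} := by
  have hne : ∀ᵐ ω ∂P, ∀ j, j ≠ n →
      vecGain ρ (fun k => W k ω) j ≠ vecGain ρ (fun k => W k ω) n := by
    rw [ae_all_iff]
    intro j
    by_cases hj : j = n
    · simp [hj]
    · have h := measure_vecGain_eq_zero hm hι hρ hW hlaw hj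
      filter_upwards [measure_eq_zero_iff_ae_notMem.1 h] with ω hω _
      exact hω
  filter_upwards [hne] with ω hω
  refine propext ⟨fun h k => ?_, fun h => ?_⟩
  · have h' : s ω = n := h
    rw [← h']
    exact hs ω k
  · by_contra hsn
    exact hω (s ω) hsn (le_antisymm (h (s ω)) (hs ω n))

/-- The law of the gains of ports `0` and `n` integrates the conditional probability that the
other ports stay below. -/
lemma measure_vecGain_mem_and_max (hm : 1 ≤ m) (hι : Fintype.card ι = 2 * m)
    (hρ : ∀ n, n ≠ 0 → |ρ n| < 1) (hW : iIndepFun W P) (hlaw : ∀ n, HasLaw (W n) (gaussVec ι) P)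
    (n : Fin N) {A : Set ℝ} (hA : MeasurableSet A) :
    P {ω | vecGain ρ (fun k => W k ω) n ∈ A ∧
        ∀ k, vecGain ρ (fun k => W k ω) k ≤ vecGain ρ (fun k => W k ω) n}
      = ∫⁻ ω, A.indicator 1 (vecGain ρ (fun k => W k ω) n)
          * {p : ℝ × ℝ | p.1 ≤ p.2}.indicator (othersBelow m ρ n)
            (vecGain ρ (fun k => W k ω) 0, vecGain ρ (fun k => W k ω) n) ∂P := by
  classical
  let S : Finset (Fin N) := {0, n}
  let T : Finset (Fin N) := (Finset.univ.erase (0 : Fin N)).erase n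
  have hST : Disjoint S T := by
    rw [Finset.disjoint_left]
    intro k hk
    simp only [S, T, Finset.mem_insert, Finset.mem_singleton, Finset.mem_erase] at hk ⊢
    tauto
  have hmeas k := (hlaw k).aemeasurable
  have hind0 := hW.indepFun_finset₀ S T hST hmeas
  have hind : IndepFun (fun ω => (W 0 ω, W n ω)) (fun ω (k : T) => W k ω) P :=
    hind0.comp (φ := fun u : S → ι → ℝ => (u ⟨0, by simp [S]⟩, u ⟨n, by simp [S]⟩)) (ψ := id)
      (by fun_prop) measurable_id
  have hY : HasLaw (fun ω (k : T) => W k ω) (Measure.pi fun _ : T => gaussVec ι) P := by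
    refine ⟨aemeasurable_pi_lambda _ fun k => hmeas k, ?_⟩
    have hWT : iIndepFun (fun k : T => W k) P := hW.precomp Subtype.val_injective
    rw [iIndepFun.map_fun_eq_pi_map (f := fun k : T => W k) (fun k => hmeas k) hWT]
    congr 1 with k : 1
    exact (hlaw k).map_eq
  let D : Set (((ι → ℝ) × (ι → ℝ)) × (T → ι → ℝ)) :=
    {q | (pairGain ρ n q.1 ∈ A ∧ ∑ i, q.1.1 i ^ 2 ≤ pairGain ρ n q.1) ∧
      ∀ k : T, ∑ i, (√(1 - ρ k ^ 2) * q.2 k i + ρ k * q.1.1 i) ^ 2 ≤ pairGain ρ n q.1}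
  have hg : Measurable fun q : ((ι → ℝ) × (ι → ℝ)) × (T → ι → ℝ) => pairGain ρ n q.1 :=
    (measurable_pairGain ρ n).comp measurable_fst
  have hD : MeasurableSet D := by
    refine ((hg hA).inter (measurableSet_le (by fun_prop) hg)).inter ?_
    have : {q : ((ι → ℝ) × (ι → ℝ)) × (T → ι → ℝ) |
        ∀ k : T, ∑ i, (√(1 - ρ k ^ 2) * q.2 k i + ρ k * q.1.1 i) ^ 2 ≤ pairGain ρ n q.1}
        = ⋂ k : T, {q | ∑ i, (√(1 - ρ k ^ 2) * q.2 k i + ρ k * q.1.1 i) ^ 2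
            ≤ pairGain ρ n q.1} := by
      ext q
      simp
    change MeasurableSet {q : ((ι → ℝ) × (ι → ℝ)) × (T → ι → ℝ) |
        ∀ k : T, ∑ i, (√(1 - ρ k ^ 2) * q.2 k i + ρ k * q.1.1 i) ^ 2 ≤ pairGain ρ n q.1}
    rw [this]
    exact MeasurableSet.iInter fun k => measurableSet_le (by fun_prop) hg
  have hset : {ω | vecGain ρ (fun k => W k ω) n ∈ A ∧
        ∀ k, vecGain ρ (fun k => W k ω) k ≤ vecGain ρ (fun k => W k ω) n}
      = {ω | ((W 0 ω, W n ω), fun k : T => W k ω) ∈ D} := by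
    ext ω
    simp only [D, mem_ofPred_eq, pairGain_eq ρ (fun k => W k ω) n, and_assoc]
    refine and_congr_right fun _ => ⟨fun h => ⟨?_, fun k => ?_⟩, fun h k => ?_⟩
    · simpa [vecGain_zero] using h 0
    · have hk : (k : Fin N) ≠ 0 := by
        have := k.2
        simp only [T, Finset.mem_erase] at this
        exact this.2.1
      simpa [vecGain_of_ne _ _ hk] using h k
    · by_cases hk0 : k = 0
      · subst hk0
        simpa [vecGain_zero] using h.1
      by_cases hkn : k = n
      · rw [hkn]
      have hkT : k ∈ T := by simp [T, hk0, hkn]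
      simpa [vecGain_of_ne _ _ hk0] using h.2 ⟨k, hkT⟩
  rw [hset, measure_mem_of_indepFun ((hmeas 0).prodMk (hmeas n)) hY hind hD]
  congr 1 with ω
  have h0 : ∑ i, W 0 ω i ^ 2 = vecGain ρ (fun k => W k ω) 0 := by rw [vecGain_zero]
  simp only [D, mem_ofPred_eq, pairGain_eq ρ (fun k => W k ω) n, h0]
  set x := vecGain ρ (fun k => W k ω) n with hx
  have hx0 : 0 ≤ x := vecGain_nonneg _ _ _
  by_cases hxA : x ∈ A
  · by_cases hle : vecGain ρ (fun k => W k ω) 0 ≤ x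
    · have hmem : (vecGain ρ (fun k => W k ω) 0, x) ∈ {p : ℝ × ℝ | p.1 ≤ p.2} := hle
      rw [indicator_of_mem hxA, indicator_of_mem hmem]
      have hbox : {y : T → ι → ℝ | (x ∈ A ∧ vecGain ρ (fun k => W k ω) 0 ≤ x) ∧
          ∀ k : T, ∑ i, (√(1 - ρ k ^ 2) * y k i + ρ k * W 0 ω i) ^ 2 ≤ x}
          = univ.pi fun k : T =>
            {v | ∑ i, (√(1 - ρ k ^ 2) * v i + ρ k * W 0 ω i) ^ 2 ≤ x} := by
        ext y
        simp [hxA, hle]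
      rw [hbox, Measure.pi_pi, othersBelow, Pi.one_apply, one_mul, ← h0]
      have hterm (k : T) : gaussVec ι {v | ∑ i, (√(1 - ρ k ^ 2) * v i + ρ k * W 0 ω i) ^ 2 ≤ x}
          = ENNReal.ofReal (phi m (ρ k) (∑ i, W 0 ω i ^ 2) x) := by
        have hk : (k : Fin N) ≠ 0 := by
          have := k.2
          simp only [T, Finset.mem_erase] at this
          exact this.2.1
        exact gaussVec_shift_sq_le hm hι (hρ k hk) _ hx0
      simp_rw [hterm]
      exact Finset.prod_coe_sort T
        fun k => ENNReal.ofReal (phi m (ρ k) (∑ i, W 0 ω i ^ 2) x)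
    · have hmem : (vecGain ρ (fun k => W k ω) 0, x) ∉ {p : ℝ × ℝ | p.1 ≤ p.2} := hle
      rw [indicator_of_notMem hmem]
      simp [hle]
  · rw [indicator_of_notMem hxA]
    simp [hxA]

lemma lintegral_vecGain_zero (hm : 1 ≤ m) (hι : Fintype.card ι = 2 * m)
    {Q : Measure Ω} (hlaw : HasLaw (W 0) (gaussVec ι) Q) {F : ℝ → ENNReal} (hF : Measurable F) :
    ∫⁻ ω, F (vecGain ρ (fun k => W k ω) 0) ∂Q
      = ∫⁻ z in Ioi 0, ENNReal.ofReal (ncPdf (m - 1) 0 z) * F z := by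
  have hι' : Fintype.card ι = 2 * ((m - 1) + 1) := by omega
  simp_rw [vecGain_zero]
  rw [← lintegral_comp_sq hι' hF, ← hlaw.map_eq, lintegral_map' (Measurable.aemeasurable (by fun_prop)) hlaw.aemeasurable]

lemma lintegral_vecGain_pair (hm : 1 ≤ m) (hι : Fintype.card ι = 2 * m)
    (hρ : ∀ n, n ≠ 0 → |ρ n| < 1) (hW : iIndepFun W P) (hlaw : ∀ n, HasLaw (W n) (gaussVec ι) P)
    {n : Fin N} (hn : n ≠ 0) {F : ℝ × ℝ → ENNReal} (hF : Measurable F) :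
    ∫⁻ ω, F (vecGain ρ (fun k => W k ω) 0, vecGain ρ (fun k => W k ω) n) ∂P
      = ∫⁻ z in Ioi 0, ENNReal.ofReal (ncPdf (m - 1) 0 z)
          * ∫⁻ x in Ioi 0, ENNReal.ofReal (shiftPdf (m - 1) (ρ n) z x) * F (z, x) := by
  have hι' : Fintype.card ι = 2 * ((m - 1) + 1) := by omega
  have hmeas : Measurable fun z => ∫⁻ x in Ioi (0 : ℝ),
      ENNReal.ofReal (shiftPdf (m - 1) (ρ n) z x) * F (z, x) :=
    ((continuous_shiftPdf (m - 1) (ρ n)).measurable.ennreal_ofReal.mul hF).lintegral_prod_right'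
  rw [← lintegral_vecGain_zero (ρ := ρ) hm hι (hlaw 0) hmeas]
  simp_rw [vecGain_zero, vecGain_of_ne _ _ hn]
  rw [lintegral_comp_of_indepFun (Z := W 0) (Y := W n) (hlaw 0).aemeasurable (hlaw n)
    (hW.indepFun hn.symm) (F := fun q : (ι → ℝ) × (ι → ℝ) => F (∑ i, q.1 i ^ 2,
      ∑ i, (√(1 - ρ n ^ 2) * q.2 i + ρ n * q.1 i) ^ 2)) (by fun_prop)]
  congr 1 with ω
  exact lintegral_comp_shift_sq hι' (hρ n hn) (W 0 ω)
    (F := fun x => F (∑ i, W 0 ω i ^ 2, x)) (by fun_prop)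

lemma measure_vecGain_mem_and_max_eq_lintegral_selDens (hm : 1 ≤ m) (hι : Fintype.card ι = 2 * m)
    (hρ : ∀ n, n ≠ 0 → |ρ n| < 1) (hW : iIndepFun W P) (hlaw : ∀ n, HasLaw (W n) (gaussVec ι) P)
    (n : Fin N) {A : Set ℝ} (hA : MeasurableSet A) :
    P {ω | vecGain ρ (fun k => W k ω) n ∈ A ∧
        ∀ k, vecGain ρ (fun k => W k ω) k ≤ vecGain ρ (fun k => W k ω) n}
      = ∫⁻ x in Ioi 0, A.indicator 1 x * selDens m ρ n x := by
  rw [measure_vecGain_mem_and_max hm hι hρ hW hlaw n hA]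
  have hA1 : Measurable (A.indicator (1 : ℝ → ENNReal)) := measurable_one.indicator hA
  have hind : Measurable ({p : ℝ × ℝ | p.1 ≤ p.2}.indicator (othersBelow m ρ n)) :=
    (measurable_othersBelow hm ρ n).indicator (measurableSet_le measurable_fst measurable_snd)
  by_cases hn : n = 0
  · subst hn
    have hF : Measurable fun z : ℝ => A.indicator 1 z
        * {p : ℝ × ℝ | p.1 ≤ p.2}.indicator (othersBelow m ρ 0) (z, z) :=
      hA1.mul (hind.comp (measurable_id.prodMk measurable_id))
    rw [lintegral_vecGain_zero (ρ := ρ) hm hι (hlaw 0) hF]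
    refine lintegral_congr fun z => ?_
    have hz : (z, z) ∈ {p : ℝ × ℝ | p.1 ≤ p.2} := le_refl z
    rw [indicator_of_mem hz, selDens, if_pos rfl]
    ring
  · have hF : Measurable fun p : ℝ × ℝ => A.indicator 1 p.2
        * {p : ℝ × ℝ | p.1 ≤ p.2}.indicator (othersBelow m ρ n) p :=
      (hA1.comp measurable_snd).mul hind
    rw [lintegral_vecGain_pair hm hι hρ hW hlaw hn hF]
    have hjoint := measurable_joint hm ρ n
    have hpull (z : ℝ) : ENNReal.ofReal (ncPdf (m - 1) 0 z)
        * ∫⁻ x in Ioi 0, ENNReal.ofReal (shiftPdf (m - 1) (ρ n) z x) * (A.indicator 1 x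
          * {p : ℝ × ℝ | p.1 ≤ p.2}.indicator (othersBelow m ρ n) (z, x))
        = ∫⁻ x in Ioi 0, A.indicator 1 x * (ENNReal.ofReal (ncPdf (m - 1) 0 z)
          * (ENNReal.ofReal (shiftPdf (m - 1) (ρ n) z x)
            * {p : ℝ × ℝ | p.1 ≤ p.2}.indicator (othersBelow m ρ n) (z, x))) := by
      rw [← lintegral_const_mul' _ _ ENNReal.ofReal_ne_top]
      refine lintegral_congr fun x => ?_
      ring
    simp_rw [hpull]
    rw [lintegral_lintegral_swap ((hA1.comp measurable_snd).mul hjoint).aemeasurable]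
    refine lintegral_congr fun x => ?_
    rw [selDens, if_neg hn, lintegral_const_mul]
    exact hjoint.comp measurable_prodMk_right

/-- Given the estimated channels, the actual gain of the selected port exceeds `r` with
probability given by the Marcum function. -/
lemma measure_max_and_lt_outdated (hm : 1 ≤ m) (hι : Fintype.card ι = 2 * m)
    (hmeas : ∀ n, AEMeasurable (W n) P) {Z : Ω → ι → ℝ} (hZ : HasLaw Z (gaussVec ι) P)
    (hind : IndepFun (fun ω k => W k ω) Z P) {μ : ℝ} (hμ : |μ| < 1) (n : Fin N) {r : ℝ}
    (hr : 0 ≤ r) :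
    P {ω | (∀ k, vecGain ρ (fun k => W k ω) k ≤ vecGain ρ (fun k => W k ω) n) ∧
        r < ∑ i, (√(1 - μ ^ 2) * Z ω i + μ * estVec ρ (fun k => W k ω) n i) ^ 2}
      = ∫⁻ ω in {ω | ∀ k, vecGain ρ (fun k => W k ω) k ≤ vecGain ρ (fun k => W k ω) n},
          ENNReal.ofReal (marcumQ m √(2 * vecGain ρ (fun k => W k ω) n * μ ^ 2 / (1 - μ ^ 2))
            √(2 * r / (1 - μ ^ 2))) ∂P := by
  have hWm : AEMeasurable (fun ω k => W k ω) P := aemeasurable_pi_lambda _ hmeas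
  have hB : MeasurableSet {w : Fin N → ι → ℝ | ∀ k, vecGain ρ w k ≤ vecGain ρ w n} := by
    have : {w : Fin N → ι → ℝ | ∀ k, vecGain ρ w k ≤ vecGain ρ w n}
        = ⋂ k, {w | vecGain ρ w k ≤ vecGain ρ w n} := by
      ext w
      simp
    rw [this]
    exact MeasurableSet.iInter fun k =>
      measurableSet_le (measurable_vecGain ρ k) (measurable_vecGain ρ n)
  have hE : NullMeasurableSet
      {ω | ∀ k, vecGain ρ (fun k => W k ω) k ≤ vecGain ρ (fun k => W k ω) n} P :=
    hWm.nullMeasurableSet_preimage hB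
  have hest := measurable_estVec (ι := ι) ρ n
  have hest' (i : ι) : Measurable fun q : (Fin N → ι → ℝ) × (ι → ℝ) => estVec ρ q.1 n i :=
    (measurable_pi_apply i).comp (hest.comp measurable_fst)
  have hD : MeasurableSet {q : (Fin N → ι → ℝ) × (ι → ℝ) |
      (∀ k, vecGain ρ q.1 k ≤ vecGain ρ q.1 n) ∧
        r < ∑ i, (√(1 - μ ^ 2) * q.2 i + μ * estVec ρ q.1 n i) ^ 2} := by
    have hlt : MeasurableSet {q : (Fin N → ι → ℝ) × (ι → ℝ) |
        r < ∑ i, (√(1 - μ ^ 2) * q.2 i + μ * estVec ρ q.1 n i) ^ 2} :=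
      measurableSet_lt measurable_const (by fun_prop)
    exact (measurable_fst hB).inter hlt
  rw [show {ω | (∀ k, vecGain ρ (fun k => W k ω) k ≤ vecGain ρ (fun k => W k ω) n) ∧
        r < ∑ i, (√(1 - μ ^ 2) * Z ω i + μ * estVec ρ (fun k => W k ω) n i) ^ 2}
      = {ω | ((fun k => W k ω), Z ω) ∈ {q : (Fin N → ι → ℝ) × (ι → ℝ) |
        (∀ k, vecGain ρ q.1 k ≤ vecGain ρ q.1 n) ∧
          r < ∑ i, (√(1 - μ ^ 2) * q.2 i + μ * estVec ρ q.1 n i) ^ 2}} from rfl,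
    measure_mem_of_indepFun hWm hZ hind hD,
    ← lintegral_indicator₀ hE]
  congr 1 with ω
  by_cases hω : ∀ k, vecGain ρ (fun k => W k ω) k ≤ vecGain ρ (fun k => W k ω) n
  · rw [indicator_of_mem (by exact hω), vecGain, ← gaussVec_lt_shift_sq hm hι hμ _ hr]
    simp [hω]
  · rw [indicator_of_notMem (by exact hω)]
    simp [hω]

end Gain

/-- Grouping a family of independent variables indexed by pairs gives independent families. -/
lemma iIndepFun_curry {Ω ι κ E : Type*} [MeasurableSpace Ω] {P : Measure Ω} [Countable ι]
    [Countable κ] [MeasurableSpace E] {Y : ι × κ → Ω → E} (hY : ∀ p, AEMeasurable (Y p) P)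
    (h : iIndepFun Y P) : iIndepFun (fun i ω j => Y (i, j) ω) P := by
  have := h.isProbabilityMeasure
  have hprob (p : ι × κ) : IsProbabilityMeasure (P.map (Y p)) :=
    Measure.isProbabilityMeasure_map (hY p)
  have hrow (i : ι) : AEMeasurable (fun ω j => Y (i, j) ω) P :=
    aemeasurable_pi_lambda _ fun j => hY (i, j)
  have hall : AEMeasurable (fun ω p => Y p ω) P := aemeasurable_pi_lambda _ hY
  have hrowlaw (i : ι) : P.map (fun ω j => Y (i, j) ω)
      = Measure.infinitePi fun j => P.map (Y (i, j)) := by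
    have hi : iIndepFun (fun j => Y (i, j)) P := h.precomp (Prod.mk_right_injective i)
    exact iIndepFun.map_fun_eq_infinitePi_map₀' (X := fun j => Y (i, j)) (fun j => hY (i, j)) hi
  rw [iIndepFun_iff_map_fun_eq_infinitePi_map₀' hrow]
  simp_rw [hrowlaw]
  rw [← Measure.infinitePi_map_curry (fun i j => P.map (Y (i, j))),
    ← iIndepFun.map_fun_eq_infinitePi_map₀' hY h,
    AEMeasurable.map_map_of_aemeasurable (by fun_prop) hall]
  rfl

section Model

variable {Ω : Type*} {N m : ℕ} (xh yh x y : Fin N → Fin m → Ω → ℝ)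

/-- The Gaussian vectors of the model: block `(0, n)` holds the estimated real and imaginary parts
of port `n`, block `(1, n)` the fresh ones. -/
def block (i : Fin 2 × Fin N) (ω : Ω) (j : Fin 2 × Fin m) : ℝ :=
  ![xh, yh, x, y] ((![![0, 1], ![2, 3]] : Fin 2 → Fin 2 → Fin 4) i.1 j.1) i.2 j.2 ω

variable {xh yh x y}

lemma estGain_eq_vecGain [NeZero N] (ρ : Fin N → ℝ) (n : Fin N) (ω : Ω) :
    estGain ρ xh yh n ω = vecGain ρ (fun k => block xh yh x y (0, k) ω) n := by
  simp only [estGain, vecGain, Fintype.sum_prod_type, Fin.sum_univ_two, ← Finset.sum_add_distrib]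
  refine Finset.sum_congr rfl fun k _ => ?_
  rw [Complex.sq_norm, Complex.normSq_apply]
  by_cases hn : n = 0
  · simp [estChannel, estVec, block, hn]
    ring
  · simp [estChannel, estVec, block, hn]
    ring

lemma outdatedGain_eq_sum [NeZero N] (ρ μ : Fin N → ℝ) (n : Fin N) (ω : Ω) :
    outdatedGain ρ μ xh yh x y n ω = ∑ i, (√(1 - μ n ^ 2) * block xh yh x y (1, n) ω i
      + μ n * estVec ρ (fun k => block xh yh x y (0, k) ω) n i) ^ 2 := by
  simp only [outdatedGain, Fintype.sum_prod_type, Fin.sum_univ_two, ← Finset.sum_add_distrib]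
  refine Finset.sum_congr rfl fun k _ => ?_
  rw [Complex.sq_norm, Complex.normSq_apply]
  by_cases hn : n = 0
  · simp [outdatedChannel, estChannel, estVec, block, hn]
    ring
  · simp [outdatedChannel, estChannel, estVec, block, hn]
    ring

variable [MeasurableSpace Ω] {P : Measure Ω}

lemma IsGaussianModel.hasLaw_entry (hG : IsGaussianModel P xh yh x y)
    (i : Fin 4 × Fin N × Fin m) :
    HasLaw ((![xh, yh, x, y] i.1) i.2.1 i.2.2) halfGaussian P := by
  obtain ⟨a, n, k⟩ := i
  fin_cases a
  · exact hG.law_xh n k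
  · exact hG.law_yh n k
  · exact hG.law_x n k
  · exact hG.law_y n k

lemma IsGaussianModel.iIndepFun_entry (hG : IsGaussianModel P xh yh x y) :
    iIndepFun (fun (p : (Fin 2 × Fin N) × (Fin 2 × Fin m)) ω => block xh yh x y p.1 ω p.2) P := by
  have hinj : Function.Injective fun p : (Fin 2 × Fin N) × (Fin 2 × Fin m) =>
      (((![![0, 1], ![2, 3]] : Fin 2 → Fin 2 → Fin 4) p.1.1 p.2.1, p.1.2, p.2.2) :
        Fin 4 × Fin N × Fin m) := by
    have h4 : ∀ a b c d : Fin 2, (![![0, 1], ![2, 3]] : Fin 2 → Fin 2 → Fin 4) a b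
        = (![![0, 1], ![2, 3]] : Fin 2 → Fin 2 → Fin 4) c d → a = c ∧ b = d := by decide
    rintro ⟨⟨a, n⟩, b, k⟩ ⟨⟨c, n'⟩, d, k'⟩ h
    simp only [Prod.mk.injEq] at h
    obtain ⟨h1, h2, h3⟩ := h
    obtain ⟨rfl, rfl⟩ := h4 a b c d h1
    simp [h2, h3]
  exact hG.indep.precomp hinj

lemma IsGaussianModel.iIndepFun_block (hG : IsGaussianModel P xh yh x y) :
    iIndepFun (block xh yh x y) P :=
  iIndepFun_curry (Y := fun p ω => block xh yh x y p.1 ω p.2)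
    (fun p => (hG.hasLaw_entry (_, p.1.2, p.2.2)).aemeasurable) hG.iIndepFun_entry

lemma IsGaussianModel.hasLaw_block (hG : IsGaussianModel P xh yh x y) (i : Fin 2 × Fin N) :
    HasLaw (block xh yh x y i) (gaussVec (Fin 2 × Fin m)) P := by
  have hlaw (j : Fin 2 × Fin m) : HasLaw (fun ω => block xh yh x y i ω j) halfGaussian P :=
    hG.hasLaw_entry (_, i.2, j.2)
  have hind : iIndepFun (fun j ω => block xh yh x y i ω j) P :=
    hG.iIndepFun_entry.precomp (Prod.mk_right_injective i)
  refine ⟨aemeasurable_pi_lambda _ fun j => (hlaw j).aemeasurable, ?_⟩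
  have h := iIndepFun.map_fun_eq_pi_map (fun j => (hlaw j).aemeasurable) hind
  rw [h]
  congr 1 with j : 1
  exact (hlaw j).map_eq

lemma IsGaussianModel.indepFun_est_fresh (hG : IsGaussianModel P xh yh x y) (n : Fin N) :
    IndepFun (fun ω k => block xh yh x y (0, k) ω) (block xh yh x y (1, n)) P := by
  classical
  let S : Finset (Fin 2 × Fin N) := Finset.univ.filter fun i => i.1 = 0
  let T : Finset (Fin 2 × Fin N) := {(1, n)}
  have hST : Disjoint S T := by simp [S, T]
  have h := hG.iIndepFun_block.indepFun_finset₀ S T hST fun i => (hG.hasLaw_block i).aemeasurable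
  exact h.comp (φ := fun (u : S → Fin 2 × Fin m → ℝ) (k : Fin N) => u ⟨(0, k), by simp [S]⟩)
    (ψ := fun (u : T → Fin 2 × Fin m → ℝ) => u ⟨(1, n), by simp [T]⟩) (by fun_prop) (by fun_prop)

lemma IsGaussianModel.iIndepFun_est (hG : IsGaussianModel P xh yh x y) :
    iIndepFun (fun k => block xh yh x y (0, k)) P :=
  hG.iIndepFun_block.precomp (Prod.mk_right_injective 0)

lemma IsGaussianModel.aemeasurable_estGain [NeZero N] {ρ : Fin N → ℝ}
    (hG : IsGaussianModel P xh yh x y) (n : Fin N) :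
    AEMeasurable (estGain ρ xh yh n) P := by
  have h : estGain ρ xh yh n = fun ω => vecGain ρ (fun k => block xh yh x y (0, k) ω) n :=
    funext fun ω => estGain_eq_vecGain ρ n ω
  rw [h]
  exact (measurable_vecGain ρ n).comp_aemeasurable
    (aemeasurable_pi_lambda _ fun k => (hG.hasLaw_block (0, k)).aemeasurable)

lemma IsGaussianModel.aemeasurable_outdatedGain [NeZero N] {ρ μ : Fin N → ℝ}
    (hG : IsGaussianModel P xh yh x y) (n : Fin N) :
    AEMeasurable (outdatedGain ρ μ xh yh x y n) P := by
  have h : outdatedGain ρ μ xh yh x y n = fun ω =>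
      ∑ i, (√(1 - μ n ^ 2) * block xh yh x y (1, n) ω i
      + μ n * estVec ρ (fun k => block xh yh x y (0, k) ω) n i) ^ 2 :=
    funext fun ω => outdatedGain_eq_sum ρ μ n ω
  rw [h]
  have h1 : AEMeasurable (fun ω => estVec ρ (fun k => block xh yh x y (0, k) ω) n) P :=
    (measurable_estVec ρ n).comp_aemeasurable
      (aemeasurable_pi_lambda _ fun k => (hG.hasLaw_block (0, k)).aemeasurable)
  have h2 := (hG.hasLaw_block (1, n)).aemeasurable
  refine Finset.aemeasurable_fun_sum _ fun i _ => ?_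
  have h1' := (measurable_pi_apply i).comp_aemeasurable h1
  have h2' := (measurable_pi_apply i).comp_aemeasurable h2
  exact ((h2'.const_mul _).add (h1'.const_mul _)).pow_const 2

end Model

section Selected

variable {Ω : Type*} [MeasurableSpace Ω] {P : Measure Ω} {N : ℕ} {s : Ω → Fin N}

lemma aemeasurable_apply_selected (hs : Measurable s) {g : Fin N → Ω → ℝ}
    (hg : ∀ n, AEMeasurable (g n) P) : AEMeasurable (fun ω => g (s ω) ω) P := by
  have h : (fun ω => g (s ω) ω) = fun ω => ∑ n, ({ω | s ω = n} : Set Ω).indicator (g n) ω := by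
    ext ω
    rw [Finset.sum_eq_single (s ω)]
    · simp
    · intro n _ hn
      have : ω ∉ {ω | s ω = n} := fun h => hn (Eq.symm h)
      exact indicator_of_notMem this (g n)
    · simp
  rw [h]
  exact Finset.aemeasurable_fun_sum _ fun n _ =>
    (hg n).indicator (hs (measurableSet_singleton n))

lemma measureReal_lt_apply_selected [IsProbabilityMeasure P] (hs : Measurable s) {g : Fin N → Ω → ℝ}
    (hg : ∀ n, AEMeasurable (g n) P) (r : ℝ) :
    P.real {ω | r < g (s ω) ω} = ∑ n, P.real ({ω | s ω = n} ∩ {ω | r < g n ω}) := by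
  have h : {ω | r < g (s ω) ω} = ⋃ n, ({ω | s ω = n} ∩ {ω | r < g n ω}) := by
    ext ω
    simp
  rw [h, measureReal_def, measure_iUnion₀, tsum_fintype, ENNReal.toReal_sum]
  · rfl
  · exact fun n _ => measure_ne_top P _
  · intro i j hij
    refine Disjoint.aedisjoint (Set.disjoint_left.2 fun ω hi hj => hij ?_)
    exact hi.1.symm.trans hj.1
  · exact fun n => (hs (measurableSet_singleton n)).nullMeasurableSet.inter
      ((hg n).nullMeasurableSet_preimage measurableSet_Ioi)

end Selected

section Main

variable {Ω : Type*} [MeasurableSpace Ω] {P : Measure Ω} [IsProbabilityMeasure P] {N m : ℕ}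
  [NeZero N] {ρ μ : Fin N → ℝ} {xh yh x y : Fin N → Fin m → Ω → ℝ} {s : Ω → Fin N}

lemma card_fin_two_prod (m : ℕ) : Fintype.card (Fin 2 × Fin m) = 2 * m := by simp

lemma IsGaussianModel.selection_ae_eq (hG : IsGaussianModel P xh yh x y) (hm : 1 ≤ m)
    (hρ : ∀ n, n ≠ 0 → |ρ n| < 1)
    (hmax : ∀ ω n, estGain ρ xh yh n ω ≤ estGain ρ xh yh (s ω) ω) (n : Fin N) :
    {ω | s ω = n} =ᵐ[P] {ω | ∀ k, vecGain ρ (fun k => block xh yh x y (0, k) ω) k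
      ≤ vecGain ρ (fun k => block xh yh x y (0, k) ω) n} := by
  refine FluidAntenna.selection_ae_eq hm (card_fin_two_prod m) hρ hG.iIndepFun_est
    (fun k => hG.hasLaw_block (0, k)) (fun ω k => ?_) n
  rw [← estGain_eq_vecGain, ← estGain_eq_vecGain]
  exact hmax ω k

/-- The estimated gain of port `n` on the event that it is selected has density `selPdf`. -/
lemma IsGaussianModel.map_estGain_restrict (hG : IsGaussianModel P xh yh x y) (hm : 1 ≤ m)
    (hρ : ∀ n, n ≠ 0 → |ρ n| < 1) (hs : Measurable s)
    (hmax : ∀ ω n, estGain ρ xh yh n ω ≤ estGain ρ xh yh (s ω) ω) (n : Fin N) :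
    (P.restrict {ω | s ω = n}).map (estGain ρ xh yh n)
      = (volume.restrict (Ioi (0 : ℝ))).withDensity
          (fun t => ENNReal.ofReal (selPdf m ρ n t)) := by
  have hsn : MeasurableSet {ω | s ω = n} := hs (measurableSet_singleton n)
  ext A hA
  rw [Measure.map_apply_of_aemeasurable (hG.aemeasurable_estGain n).restrict hA,
    Measure.restrict_apply' hsn, withDensity_apply _ hA]
  have hset : (estGain ρ xh yh n ⁻¹' A ∩ {ω | s ω = n} : Set Ω) =ᵐ[P]
      {ω | vecGain ρ (fun k => block xh yh x y (0, k) ω) n ∈ A ∧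
        ∀ k, vecGain ρ (fun k => block xh yh x y (0, k) ω) k
          ≤ vecGain ρ (fun k => block xh yh x y (0, k) ω) n} := by
    have h : estGain ρ xh yh n ⁻¹' A
        = {ω | vecGain ρ (fun k => block xh yh x y (0, k) ω) n ∈ A} := by
      ext ω
      simp [← estGain_eq_vecGain]
    rw [h]
    exact (ae_eq_refl _).inter (hG.selection_ae_eq hm hρ hmax n)
  rw [measure_congr hset, measure_vecGain_mem_and_max_eq_lintegral_selDens hm
    (card_fin_two_prod m) hρ hG.iIndepFun_est (fun k => hG.hasLaw_block (0, k)) n hA,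
    ← lintegral_indicator hA]
  refine setLIntegral_congr_fun measurableSet_Ioi fun t ht => ?_
  by_cases htA : t ∈ A
  · simp [htA, ofReal_selPdf hm hρ n ht]
  · simp [htA]

lemma IsGaussianModel.measure_selected_and_lt (hG : IsGaussianModel P xh yh x y) (hm : 1 ≤ m)
    (hρ : ∀ n, n ≠ 0 → |ρ n| < 1) (hμ : ∀ n, |μ n| < 1) (hs : Measurable s)
    (hmax : ∀ ω n, estGain ρ xh yh n ω ≤ estGain ρ xh yh (s ω) ω) (n : Fin N) {r : ℝ}
    (hr : 0 ≤ r) :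
    P ({ω | s ω = n} ∩ {ω | r < outdatedGain ρ μ xh yh x y n ω})
      = ∫⁻ t in Ioi 0, ENNReal.ofReal
          (marcumQ m √(2 * t * μ n ^ 2 / (1 - μ n ^ 2)) √(2 * r / (1 - μ n ^ 2))
            * selPdf m ρ n t) := by
  have hsel := hG.selection_ae_eq hm hρ hmax n
  have hset : ({ω | s ω = n} ∩ {ω | r < outdatedGain ρ μ xh yh x y n ω} : Set Ω) =ᵐ[P]
      {ω | (∀ k, vecGain ρ (fun k => block xh yh x y (0, k) ω) k
          ≤ vecGain ρ (fun k => block xh yh x y (0, k) ω) n) ∧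
        r < ∑ i, (√(1 - μ n ^ 2) * block xh yh x y (1, n) ω i
          + μ n * estVec ρ (fun k => block xh yh x y (0, k) ω) n i) ^ 2} := by
    simp_rw [outdatedGain_eq_sum]
    exact hsel.inter (ae_eq_refl _)
  have hQ : Measurable fun t => ENNReal.ofReal
      (marcumQ m √(2 * t * μ n ^ 2 / (1 - μ n ^ 2)) √(2 * r / (1 - μ n ^ 2))) :=
    (measurable_marcumQ_comp m hm (by fun_prop) (by fun_prop)).ennreal_ofReal
  rw [measure_congr hset, measure_max_and_lt_outdated hm (card_fin_two_prod m)
    (fun k => (hG.hasLaw_block (0, k)).aemeasurable) (hG.hasLaw_block (1, n))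
    (hG.indepFun_est_fresh n) (hμ n) n hr, ← Measure.restrict_congr_set hsel]
  simp_rw [← estGain_eq_vecGain]
  rw [← lintegral_map' (f := fun t => ENNReal.ofReal
      (marcumQ m √(2 * t * μ n ^ 2 / (1 - μ n ^ 2)) √(2 * r / (1 - μ n ^ 2)))) hQ.aemeasurable
      (hG.aemeasurable_estGain n).restrict,
    hG.map_estGain_restrict hm hρ hs hmax n,
    lintegral_withDensity_eq_lintegral_mul₀ (aemeasurable_selPdf hm hρ n).ennreal_ofReal
      hQ.aemeasurable]
  refine lintegral_congr fun t => ?_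
  rw [Pi.mul_apply, ENNReal.ofReal_mul
    (marcumQ_nonneg m hm (Real.sqrt_nonneg _) (Real.sqrt_nonneg _)), mul_comm]

lemma IsGaussianModel.integrableOn_marcumQ_mul_selPdf (hG : IsGaussianModel P xh yh x y)
    (hm : 1 ≤ m) (hρ : ∀ n, n ≠ 0 → |ρ n| < 1) (hμ : ∀ n, |μ n| < 1) (hs : Measurable s)
    (hmax : ∀ ω n, estGain ρ xh yh n ω ≤ estGain ρ xh yh (s ω) ω) (n : Fin N) {r : ℝ}
    (hr : 0 ≤ r) :
    IntegrableOn (fun t => marcumQ m √(2 * t * μ n ^ 2 / (1 - μ n ^ 2))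
      √(2 * r / (1 - μ n ^ 2)) * selPdf m ρ n t) (Ioi 0) := by
  have hmeas : AEMeasurable (fun t => marcumQ m √(2 * t * μ n ^ 2 / (1 - μ n ^ 2))
      √(2 * r / (1 - μ n ^ 2)) * selPdf m ρ n t) (volume.restrict (Ioi 0)) :=
    (measurable_marcumQ_comp m hm (by fun_prop) (by fun_prop)).aemeasurable.mul
      (aemeasurable_selPdf hm hρ n)
  refine (lintegral_ofReal_ne_top_iff_integrable hmeas.aestronglyMeasurable ?_).1 ?_
  · filter_upwards [ae_restrict_mem measurableSet_Ioi] with t ht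
    exact mul_nonneg (marcumQ_nonneg m hm (Real.sqrt_nonneg _) (Real.sqrt_nonneg _))
      (selPdf_nonneg hm hρ n ht)
  · rw [← hG.measure_selected_and_lt hm hρ hμ hs hmax n hr]
    exact measure_ne_top P _

lemma IsGaussianModel.measureReal_selected_and_lt (hG : IsGaussianModel P xh yh x y)
    (hm : 1 ≤ m) (hρ : ∀ n, n ≠ 0 → |ρ n| < 1) (hμ : ∀ n, |μ n| < 1) (hs : Measurable s)
    (hmax : ∀ ω n, estGain ρ xh yh n ω ≤ estGain ρ xh yh (s ω) ω) (n : Fin N) {r : ℝ}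
    (hr : 0 ≤ r) :
    P.real ({ω | s ω = n} ∩ {ω | r < outdatedGain ρ μ xh yh x y n ω})
      = ∫ t in Ioi (0 : ℝ), marcumQ m √(2 * t * μ n ^ 2 / (1 - μ n ^ 2))
          √(2 * r / (1 - μ n ^ 2)) * selPdf m ρ n t := by
  have hnn : 0 ≤ᵐ[volume.restrict (Ioi 0)] fun t : ℝ =>
      marcumQ m √(2 * t * μ n ^ 2 / (1 - μ n ^ 2)) √(2 * r / (1 - μ n ^ 2)) * selPdf m ρ n t := by
    filter_upwards [ae_restrict_mem measurableSet_Ioi] with t ht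
    exact mul_nonneg (marcumQ_nonneg m hm (Real.sqrt_nonneg _) (Real.sqrt_nonneg _))
      (selPdf_nonneg hm hρ n ht)
  rw [measureReal_def, hG.measure_selected_and_lt hm hρ hμ hs hmax n hr,
    ← ofReal_integral_eq_lintegral_ofReal
      (hG.integrableOn_marcumQ_mul_selPdf hm hρ hμ hs hmax n hr) hnn,
    ENNReal.toReal_ofReal (integral_nonneg_of_ae hnn)]

end Main

end FluidAntenna

end

theorem theorem2 {Ω : Type*} [MeasurableSpace Ω] (P : Measure Ω) [IsProbabilityMeasure P]
    (N m : ℕ) [NeZero N] (hm : 1 ≤ m)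
    (ρ μ : Fin N → ℝ) (hρ : ∀ n, n ≠ 0 → |ρ n| < 1) (hμ : ∀ n, |μ n| < 1)
    (xh yh x y : Fin N → Fin m → Ω → ℝ)
    (hG : FluidAntenna.IsGaussianModel P xh yh x y)
    -- the activated port has the largest estimated gain; ties are broken arbitrarily
    (s : Ω → Fin N) (hs : Measurable s)
    (hmax : ∀ ω n, FluidAntenna.estGain ρ xh yh n ω ≤ FluidAntenna.estGain ρ xh yh (s ω) ω) :
    -- `selPdf m ρ n` is the density of the estimated gain of port `n` on the event `s = n`
    (∀ n, (P.restrict {ω | s ω = n}).map (FluidAntenna.estGain ρ xh yh n)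
        = (volume.restrict (Ioi (0 : ℝ))).withDensity
            (fun t => ENNReal.ofReal (FluidAntenna.selPdf m ρ n t))) ∧
    (∀ n, ∀ t > 0, 0 ≤ FluidAntenna.selPdf m ρ n t) ∧
    ∀ r : ℝ, 0 ≤ r →
      (∀ n, IntegrableOn (fun t =>
          FluidAntenna.marcumQ m (√(2 * t * μ n ^ 2 / (1 - μ n ^ 2))) (√(2 * r / (1 - μ n ^ 2)))
            * FluidAntenna.selPdf m ρ n t) (Ioi 0)) ∧
      cdf (P.map (fun ω => FluidAntenna.outdatedGain ρ μ xh yh x y (s ω) ω)) r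
        = 1 - ∑ n, ∫ t in Ioi (0 : ℝ),
            FluidAntenna.marcumQ m (√(2 * t * μ n ^ 2 / (1 - μ n ^ 2))) (√(2 * r / (1 - μ n ^ 2)))
              * FluidAntenna.selPdf m ρ n t := by
  refine ⟨fun n => hG.map_estGain_restrict hm hρ hs hmax n,
    fun n t ht => FluidAntenna.selPdf_nonneg hm hρ n ht, fun r hr =>
    ⟨fun n => hG.integrableOn_marcumQ_mul_selPdf hm hρ hμ hs hmax n hr, ?_⟩⟩
  have hg := hG.aemeasurable_outdatedGain (ρ := ρ) (μ := μ)
  have hsel := FluidAntenna.aemeasurable_apply_selected hs hg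
  have := Measure.isProbabilityMeasure_map hsel
  have hlt : NullMeasurableSet {ω | r < FluidAntenna.outdatedGain ρ μ xh yh x y (s ω) ω} P :=
    hsel.nullMeasurableSet_preimage measurableSet_Ioi
  rw [cdf_eq_real, map_measureReal_apply_of_aemeasurable hsel measurableSet_Iic]
  have hcompl : (fun ω => FluidAntenna.outdatedGain ρ μ xh yh x y (s ω) ω) ⁻¹' Iic r
      = {ω | r < FluidAntenna.outdatedGain ρ μ xh yh x y (s ω) ω}ᶜ := by
    ext ω
    simp
  rw [hcompl, probReal_compl_eq_one_sub₀ hlt, FluidAntenna.measureReal_lt_apply_selected hs hg]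
  simp_rw [hG.measureReal_selected_and_lt hm hρ hμ hs hmax _ hr]
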